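/- **Conventions.** Let $K$ be the transition matrix of an irreducible, reversible, $\tfrac12$-lazy ($K(x,x)\ge \tfrac12$ for all $x$) Markov chain $\{Z_t\}_{t\ge 0}$ on a finite set $\Theta$ with stationary distribution $\tilde\pi$, and write $\mathbb P_z,\mathbb E_z$ for the law of the chain with $Z_0=z$ and its expectation. The mixing time is $$\tau_{\mathrm{mix}}=\inf\Big\{t\in\mathbb N,\ t>0:\ \sup_{x}\|K^t(x,\cdot)-\tilde\pi\|_{\mathrm{TV}}<\tfrac14\Big\},\qquad \|\mu-\nu\|_{\mathrm{TV}}=\sup_A(\mu(A)-\nu(A)),$$ and for $0<\alpha<\tfrac12$ let $t_H(\alpha)=\max\{\mathbb E_x[\tau_A]: x\in\Theta,\ A\subset\Theta,\ \tilde\pi(A)\ge\alpha\}$, where $\tau_A=\inf\{t\ge 0: Z_t\in A\}$. Call $c_\alpha>0$ and $c'_\alpha>0$ *admissible* for $\alpha$ if $$\tau_{\mathrm{mix}}\le c_\alpha\, t_H(\alpha),\qquad\text{respectively}\qquad t_H(\alpha)\le c'_\alpha\,\tau_{\mathrm{mix}},$$ for every irreducible, reversible, $\tfrac12$-lazy chain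 on every finite set with at least two points. For $S\subset\Theta$ put $\eta_S(0)=0$ and $\eta_S(s)=\inf\{t>\eta_S(s-1): Z_t\in S\}$. The trace of the chain on $S$ is the Markov chain $s\mapsto Z_{\eta_S(s)}$ on $S$, with transition matrix $K_S(x,y)=\mathbb P_x[Z_{\eta_S(1)}=y]$, $x,y\in S$, and stationary distribution $\tilde\pi(\cdot)/\tilde\pi(S)$. **Lemma 3.1.** For every $0<\alpha<\tfrac12$ admissible constants $c_\alpha$ and $c'_\alpha$ exist. Moreover, let $0<a<\tfrac12$ and $1-a<\beta<1$, put $\gamma=\min\big(\tfrac12,\tfrac{a+\beta-1}{\beta}\big)$, and let $c_a$ and $c'_\gamma$ be admissible for $a$ and $\gamma$. Let $\{Z_t\}$ be an irreducible, reversible, $\tfrac12$-lazy Markov chain on a finite set $\Theta=\bigsqcup_{k=1}^n\Theta_k$ with stationary distribution $\tilde\pi$, let $\varphi_k$ be the mixing time of its trace on $\Theta_k$, let $\kappa_k(T)=\sum_{t=1}^T\mathbf 1_{Z_t\in\Theta_k}$, and let $I\subset\{1,\dots,n\}$ satisfy $\sum_{k\in I}\tilde\pi(\Theta_k)>\beta$.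 Then $$\frac{\tau_{\mathrm{mix}}}{4c_a}\ \le\ \inf\Big\{T\in\mathbb N:\ \inf_{0<t<T}\ \sup_{k\in I}\Big(\frac{c'_\gamma\,\varphi_k}{t}+\sup_{z\in\Theta}\mathbb P_z[\kappa_k(T)<t]\Big)<\frac14\Big\},$$ where $t$ ranges over the real numbers in $(0,T)$ and $\inf\emptyset=\infty$. -/

import Mathlib

open MeasureTheory ProbabilityTheory
open scoped ENNReal

universe u

namespace DecomposableChain

noncomputable section

/-! ### Finite Markov chains: stationary law, distance to it, mixing time -/

section Matrices

variable {Θ : Type u} [Fintype Θ] [DecidableEq Θ]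

/-- `K` is the transition matrix of an irreducible, reversible, 1/2-lazy Markov chain on the
finite set `Θ`, and `π` is its stationary distribution. (Stationarity follows from detailed
balance, and aperiodicity from laziness.) -/
structure IsLazyReversible (K : Matrix.rowStochastic ℝ Θ) (π : Θ → ℝ) : Prop where
  prob : π ∈ stdSimplex ℝ Θ
  detailed_balance : ∀ x y, π x * K.1 x y = π y * K.1 y x
  irreducible : K.1.IsIrreducible
  lazy : ∀ x, 1 / 2 ≤ K.1 x x

/-- The total variation distance `sup_A (μ(A) - ν(A))` on a finite set. -/
def tvDist (μ ν : Θ → ℝ) : ℝ :=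
  ⨆ A : Finset Θ, (∑ x ∈ A, μ x - ∑ x ∈ A, ν x)

/-- The mixing time `inf {t > 0 : sup_x ‖K^t(x, ·) - π‖_TV < 1/4}`, which is `∞` if there is no
such `t`. -/
def mixingTime (K : Matrix Θ Θ ℝ) (π : Θ → ℝ) : ℝ≥0∞ :=
  ⨅ (t : ℕ) (_ : 0 < t ∧ ∀ x, tvDist ((K ^ t) x) π < 1 / 4), (t : ℝ≥0∞)

end Matrices

/-! ### The law of the chain on the space of trajectories -/

section Trajectories

variable {Θ : Type u} [Fintype Θ] [DecidableEq Θ] [MeasurableSpace Θ] [DiscreteMeasurableSpace Θ]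

/-- The transition matrix as a kernel: from `x` the chain moves to `y` with probability
`K x y`. -/
def stepKernel (K : Matrix.rowStochastic ℝ Θ) : Kernel Θ Θ :=
  Kernel.ofFunOfCountable fun x => ∑ y, ENNReal.ofReal (K.1 x y) • Measure.dirac y

instance (K : Matrix.rowStochastic ℝ Θ) : IsMarkovKernel (stepKernel K) where
  isProbabilityMeasure x := by
    have h := (Matrix.mem_rowStochastic_iff_sum.1 K.2)
    refine ⟨?_⟩
    change (∑ y, ENNReal.ofReal (K.1 x y) • Measure.dirac y : Measure Θ) Set.univ = 1
    simp only [Measure.coe_finsetSum, Finset.sum_apply, Measure.smul_apply, measure_univ,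
      smul_eq_mul, mul_one]
    rw [← ENNReal.ofReal_sum_of_nonneg (fun y _ => h.1 x y), h.2 x, ENNReal.ofReal_one]

/-- The transition from the history up to time `n` to the state at time `n + 1`: it depends on
the current state only. -/
def historyKernel (K : Matrix.rowStochastic ℝ Θ) (n : ℕ) :
    Kernel ((i : Finset.Iic n) → (fun _ : ℕ => Θ) i) Θ :=
  (stepKernel K).comap (fun h => h ⟨n, Finset.mem_Iic.2 le_rfl⟩) (measurable_pi_apply _)

instance (K : Matrix.rowStochastic ℝ Θ) (n : ℕ) : IsMarkovKernel (historyKernel K n) := by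
  unfold historyKernel; infer_instance

/-- `P_z`: the law on trajectories `Z : ℕ → Θ` of the Markov chain with transition matrix `K`
started at `Z 0 = z`. -/
def pathLaw (K : Matrix.rowStochastic ℝ Θ) (z : Θ) : Measure (ℕ → Θ) :=
  Kernel.trajMeasure (X := fun _ => Θ) (Measure.dirac z) (historyKernel K)

/-! ### Hitting times of large sets -/

/-- The hitting time `inf {t ≥ 0 : Z_t ∈ A}` of the set `A` by the trajectory `Z`. -/
def hittingTime (A : Finset Θ) (Z : ℕ → Θ) : ℝ≥0∞ :=
  ⨅ (t : ℕ) (_ : Z t ∈ A), (t : ℝ≥0∞)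

/-- `t_H(α)`: the largest expected hitting time `E_x[τ_A]` over all starting points `x` and all
sets `A` of stationary mass at least `α`. -/
def maxHittingTime (K : Matrix.rowStochastic ℝ Θ) (π : Θ → ℝ) (α : ℝ) : ℝ≥0∞ :=
  ⨆ (x : Θ) (A : Finset Θ) (_ : α ≤ ∑ y ∈ A, π y), ∫⁻ Z, hittingTime A Z ∂(pathLaw K x)

/-! ### Visits to a part of the state space and the trace chain -/

/-- The successive times `η(0) = 0`, `η(s) = inf {t > η(s - 1) : Z_t ∈ S}` at which the
trajectory `Z` visits `S`. -/
def visitTime (S : Finset Θ) (Z : ℕ → Θ) : ℕ → ℕ∞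
  | 0 => 0
  | s + 1 => ⨅ (t : ℕ) (_ : visitTime S Z s < t ∧ Z t ∈ S), (t : ℕ∞)

/-- The number `κ(T) = ∑_{t=1}^T 1_{Z_t ∈ S}` of visits to `S` up to time `T`. -/
def occupation (S : Finset Θ) (Z : ℕ → Θ) (T : ℕ) : ℕ :=
  ∑ t ∈ Finset.Icc 1 T, if Z t ∈ S then 1 else 0

/-- The transition matrix of the trace `s ↦ Z_{η(s)}` of the chain on `S`: its entry at `(x, y)`
is `P_x[Z_{η(1)} = y]`. -/
def traceMatrix (K : Matrix.rowStochastic ℝ Θ) (S : Finset Θ) : Matrix S S ℝ :=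
  fun x y => (pathLaw K x).real {Z | ∃ t : ℕ, visitTime S Z 1 = t ∧ Z t = y}

/-- The stationary distribution of the trace chain: `π` conditioned on `S`. -/
def condLaw (π : Θ → ℝ) (S : Finset Θ) : S → ℝ :=
  fun x => π x / ∑ y ∈ S, π y

/-- The mixing time `φ` of the trace of the chain on `S`. -/
def traceMixingTime (K : Matrix.rowStochastic ℝ Θ) (π : Θ → ℝ) (S : Finset Θ) : ℝ≥0∞ :=
  mixingTime (traceMatrix K S) (condLaw π S)

/-- `inf {T : inf_{0 < t < T} sup_{k ∈ I} (C φ_k / t + sup_z P_z[κ_k(T) < t]) < 1/4}`, where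
`T` runs over the natural numbers and `t` over the real numbers; it is `∞` if there is no
such `T`. -/
def occupationBound (K : Matrix.rowStochastic ℝ Θ) (π : Θ → ℝ) {n : ℕ} (part : Fin n → Finset Θ)
    (I : Finset (Fin n)) (C : ℝ) : ℝ≥0∞ :=
  ⨅ (T : ℕ) (_ : (⨅ t ∈ Set.Ioo (0 : ℝ) T, ⨆ k ∈ I,
      (ENNReal.ofReal C * traceMixingTime K π (part k) / ENNReal.ofReal t +
        ⨆ z, pathLaw K z {Z | (occupation (part k) Z T : ℝ) < t})) < 1 / 4), (T : ℝ≥0∞)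

end Trajectories

/-! ### Universal constants comparing mixing times with hitting times of large sets -/

/-- `c` is an admissible constant `c_α`: `t_mix ≤ c t_H(α)` for all irreducible, reversible, lazy
chains on finite sets with at least two points. (On one point the mixing time is `1`, being an
infimum over `t > 0`, whereas hitting times vanish.) -/
def IsUpperConstant (α c : ℝ) : Prop :=
  0 < c ∧ ∀ (S : Type u) [Fintype S] [DecidableEq S] [MeasurableSpace S]
    [DiscreteMeasurableSpace S] [Nontrivial S] (K : Matrix.rowStochastic ℝ S) (π : S → ℝ),
    IsLazyReversible K π → mixingTime K.1 π ≤ ENNReal.ofReal c * maxHittingTime K π α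

/-- `c'` is an admissible constant `c'_α`: `t_H(α) ≤ c' t_mix` for all irreducible, reversible,
lazy chains on finite sets with at least two points. -/
def IsLowerConstant (α c' : ℝ) : Prop :=
  0 < c' ∧ ∀ (S : Type u) [Fintype S] [DecidableEq S] [MeasurableSpace S]
    [DiscreteMeasurableSpace S] [Nontrivial S] (K : Matrix.rowStochastic ℝ S) (π : S → ℝ),
    IsLazyReversible K π → maxHittingTime K π α ≤ ENNReal.ofReal c' * mixingTime K.1 π

end

end DecomposableChain

/-! Everything rests on the tail `surv K A t x`, the probability of not having met `A` by time `t`.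
If the tail at one time `T` is at most `p < 1` from every start, the Markov property gives expected
hitting times at most `T / (1 - p)`.

Hitting times by mixing times: each block of `t_mix` steps halves the oscillation of the iterates of
the indicator of the complement of `A`. After boundedly many blocks the tail is at most `1 - α / 2`
everywhere (`IsLazyReversible.maxHittingTime_le`).

Mixing times by hitting times: let `n` bound the expected hitting times of all sets of mass at least
one half. Solving the Poisson equation and splitting at a median yields a Poincaré inequality with
constant `n`. Its exponential decay in `L²` alone would cost a logarithm of the smallest stationary
mass. Instead, for `f` a centred indicator, reversibility and laziness make the autocorrelations of
`f` behave like moments on `[0, 1]`. Hence the norm of `K ^ s f` and its later increments are small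
once `s` is a large multiple of `n`. Thus on a set `G` of mass at least one half all the values `K ^
(s + r) f` with `r ≤ H` are small simultaneously. From any start the chain meets `G` within `H = 16
n` steps with high probability, which carries the bound to every state
(`IsLazyReversible.abs_pow_mulVec_le`).

The decomposition bound: a set `A` of mass at least `a` fills a proportion at least `γ` of some part
with index in `I`. The trace on that part is again irreducible, reversible and lazy, so Markov's
inequality bounds the probability of making `t` visits to the part without meeting `A`. Adding the
probability of fewer than `t` visits by time `T`, the tail at `T` is at most `1/4` from every start.
Hence the expected hitting time is at most `4 T / 3`, and the constant `c_a` converts this into a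
mixing bound. -/

namespace DecomposableChain

noncomputable section

open Matrix

/-! ### Path measure and the Markov property -/

section Markov

variable {Θ : Type u} [Fintype Θ] [DecidableEq Θ] [MeasurableSpace Θ] [DiscreteMeasurableSpace Θ]

/-- Prepend a state to a trajectory. -/
def consPath (x : Θ) (Z : ℕ → Θ) : ℕ → Θ
  | 0 => x
  | n + 1 => Z n

omit [Fintype Θ] [DecidableEq Θ] [DiscreteMeasurableSpace Θ] in
lemma measurable_consPath (x : Θ) : Measurable (consPath x) := by
  refine measurable_pi_lambda _ fun n => ?_
  cases n with
  | zero => exact measurable_const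
  | succ n => exact measurable_pi_apply n

omit [Fintype Θ] [DecidableEq Θ] in
lemma measurableSet_forall_le_eq (w : ℕ → Θ) (a : ℕ) :
    MeasurableSet {Z : ℕ → Θ | ∀ i ≤ a, Z i = w i} := by
  have : {Z : ℕ → Θ | ∀ i ≤ a, Z i = w i} = ⋂ i ∈ Set.Iic a, {Z | Z i = w i} := by
    ext; simp
  rw [this]
  exact MeasurableSet.biInter (Set.to_countable _) fun i _ => by
    have h : Measurable fun Z : ℕ → Θ => Z i := measurable_pi_apply i
    exact h (MeasurableSet.of_discrete (s := ({w i} : Set Θ)))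

omit [DecidableEq Θ] in
/-- Two finite measures on trajectories agreeing on the elementary cylinders are equal. -/
lemma measure_ext_of_cylinder {μ ν : Measure (ℕ → Θ)} [IsProbabilityMeasure μ]
    [IsProbabilityMeasure ν]
    (h : ∀ (w : ℕ → Θ) (a : ℕ), μ {Z | ∀ i ≤ a, Z i = w i} = ν {Z | ∀ i ≤ a, Z i = w i}) :
    μ = ν := by
  classical
  have key : ∀ a, μ.map (Preorder.frestrictLe (π := fun _ : ℕ => Θ) a) =
      ν.map (Preorder.frestrictLe (π := fun _ : ℕ => Θ) a) := by
    intro a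
    refine Measure.ext_of_singleton fun v => ?_
    rw [Measure.map_apply (by fun_prop) (MeasurableSet.singleton _),
      Measure.map_apply (by fun_prop) (MeasurableSet.singleton _)]
    have : (Preorder.frestrictLe (π := fun _ : ℕ => Θ) a) ⁻¹' {v} = {Z | ∀ i ≤ a, Z i =
        (fun j => if hj : j ≤ a then v ⟨j, Finset.mem_Iic.2 hj⟩ else v ⟨a, by simp⟩) i} := by
      ext Z
      simp only [Set.mem_preimage, Set.mem_singleton_iff, Set.mem_ofPred_eq]
      constructor
      · rintro rfl i hi
        simp [hi]
      · intro hZ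
        ext ⟨i, hi⟩
        have := hZ i (Finset.mem_Iic.1 hi)
        simpa [Finset.mem_Iic.1 hi] using this
    rw [this, h]
  refine MeasureTheory.ext_of_generate_finite _ generateFrom_measurableCylinders.symm
    isPiSystem_measurableCylinders ?_ (by simp)
  intro s hs
  obtain ⟨N, S, mS, rfl⟩ : ∃ N S, MeasurableSet S ∧ s = cylinder (Finset.Iic N) S := by
    simpa [measurableCylinders_nat] using hs
  have := congrArg (fun m => m S) (key N)
  simp only at this
  rwa [Measure.map_apply (by fun_prop) mS, Measure.map_apply (by fun_prop) mS] at this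

variable (K : Matrix.rowStochastic ℝ Θ)

lemma stepKernel_singleton (x y : Θ) : stepKernel K x {y} = ENNReal.ofReal (K.1 x y) := by
  change (∑ y, ENNReal.ofReal (K.1 x y) • Measure.dirac y : Measure Θ) {y} = _
  simp [Measure.coe_finsetSum, Measure.dirac_apply', Set.indicator_apply]

instance (x : Θ) : IsProbabilityMeasure (pathLaw K x) := by
  unfold pathLaw; infer_instance

lemma pathLaw_cylinder_succ (x : Θ) (w : ℕ → Θ) (a : ℕ) :
    pathLaw K x {Z | ∀ i ≤ a + 1, Z i = w i} =
      pathLaw K x {Z | ∀ i ≤ a, Z i = w i} * ENNReal.ofReal (K.1 (w a) (w (a + 1))) := by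
  have h := Kernel.map_frestrictLe_trajMeasure_compProd_eq_map_trajMeasure
    (X := fun _ : ℕ => Θ) (μ₀ := Measure.dirac x) (κ := historyKernel K) (a := a)
  have h2 := congrArg (fun m => m (({fun i : Finset.Iic a => w i} : Set (Finset.Iic a → Θ)) ×ˢ
    ({w (a + 1)} : Set Θ))) h
  have e : (fun Z : ℕ → Θ => (Preorder.frestrictLe (π := fun _ : ℕ => Θ) a Z, Z (a + 1))) ⁻¹'
      ({fun i : Finset.Iic a => w i} ×ˢ {w (a + 1)}) = {Z | ∀ i ≤ a + 1, Z i = w i} := by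
    ext Z
    simp only [Set.mem_preimage, Set.mem_prod, Set.mem_singleton_iff, Set.mem_ofPred_eq]
    constructor
    · rintro ⟨h1, h2⟩ i hi
      rcases Nat.lt_or_ge a i with hai | hai
      · obtain rfl : i = a + 1 := by omega
        exact h2
      · exact congrFun h1 ⟨i, Finset.mem_Iic.2 hai⟩
    · intro hZ
      refine ⟨?_, hZ _ le_rfl⟩
      ext ⟨i, hi⟩
      exact hZ i (by have := Finset.mem_Iic.1 hi; omega)
  have e2 : (Preorder.frestrictLe (π := fun _ : ℕ => Θ) a) ⁻¹' {fun i : Finset.Iic a => w i} =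
      {Z | ∀ i ≤ a, Z i = w i} := by
    ext Z
    simp only [Set.mem_preimage, Set.mem_singleton_iff, Set.mem_ofPred_eq]
    constructor
    · intro h1 i hi
      exact congrFun h1 ⟨i, Finset.mem_Iic.2 hi⟩
    · intro hZ
      ext ⟨i, hi⟩
      exact hZ i (by have := Finset.mem_Iic.1 hi; omega)
  rw [Measure.map_apply (by fun_prop) (by measurability), e,
    Measure.compProd_apply_prod (by measurability) (by measurability),
    Measure.restrict_singleton, lintegral_smul_measure, lintegral_dirac,
    Measure.map_apply (by fun_prop) (by measurability), e2] at h2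
  rw [pathLaw, ← h2, smul_eq_mul, ← stepKernel_singleton K]
  rfl

lemma pathLaw_cylinder_zero (x : Θ) (w : ℕ → Θ) :
    pathLaw K x {Z | ∀ i ≤ 0, Z i = w i} = if x = w 0 then 1 else 0 := by
  have h1 : pathLaw K x = Kernel.traj (X := fun _ : ℕ => Θ) (historyKernel K) 0 (fun _ => x) := by
    have e : (Measure.dirac x).map (MeasurableEquiv.piUnique (fun _ : Finset.Iic 0 => Θ)).symm =
        Measure.dirac (fun _ => x) := by
      rw [Measure.map_dirac' (MeasurableEquiv.measurable _)]
      rfl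
    change Measure.bind ((Measure.dirac x).map
      (MeasurableEquiv.piUnique (fun _ : Finset.Iic 0 => Θ)).symm) _ = _
    rw [e]
    exact Measure.dirac_bind (Kernel.measurable _) _
  have e2 : (Preorder.frestrictLe (π := fun _ : ℕ => Θ) 0) ⁻¹' {fun i : Finset.Iic 0 => w i} =
      {Z | ∀ i ≤ 0, Z i = w i} := by
    ext Z
    simp only [Set.mem_preimage, Set.mem_singleton_iff, Set.mem_ofPred_eq]
    constructor
    · intro h1 i hi
      exact congrFun h1 ⟨i, Finset.mem_Iic.2 hi⟩
    · intro hZ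
      ext ⟨i, hi⟩
      exact hZ i (by have := Finset.mem_Iic.1 hi; omega)
  rw [h1, ← e2, ← Measure.map_apply (Preorder.measurable_frestrictLe (X := fun _ : ℕ => Θ) 0) (by measurability),
    Kernel.traj_map_frestrictLe_apply, Kernel.partialTraj_self, Kernel.id_apply,
    Measure.dirac_apply' _ (by measurability)]
  by_cases hx : x = w 0
  · rw [if_pos hx, Set.indicator_of_mem]
    · rfl
    · ext ⟨i, hi⟩
      have : i = 0 := by simpa using hi
      subst this
      exact hx
  · rw [if_neg hx, Set.indicator_of_notMem]
    intro h
    exact hx (congrFun h ⟨0, by simp⟩)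

/-- The Markov property at time one. -/
lemma pathLaw_apply (x : Θ) {E : Set (ℕ → Θ)} (hE : MeasurableSet E) :
    pathLaw K x E = ∑ y, ENNReal.ofReal (K.1 x y) * pathLaw K y (consPath x ⁻¹' E) := by
  have hK := Matrix.mem_rowStochastic_iff_sum.1 K.2
  -- `M` takes one step and then restarts. It suffices to match cylinder masses, which for both
  -- measures gain the same last transition factor when the cylinder is lengthened.
  set M : Measure (ℕ → Θ) := ∑ y, ENNReal.ofReal (K.1 x y) • (pathLaw K y).map (consPath x)
    with hM
  have hMa : ∀ F : Set (ℕ → Θ), MeasurableSet F → M F =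
      ∑ y, ENNReal.ofReal (K.1 x y) * pathLaw K y (consPath x ⁻¹' F) := by
    intro F hF
    simp only [hM, Measure.coe_finsetSum, Finset.sum_apply, Measure.smul_apply, smul_eq_mul]
    exact Finset.sum_congr rfl fun y _ => by rw [Measure.map_apply (measurable_consPath x) hF]
  have hsum : ∑ y, ENNReal.ofReal (K.1 x y) = 1 := by
    rw [← ENNReal.ofReal_sum_of_nonneg (fun y _ => hK.1 x y), hK.2 x, ENNReal.ofReal_one]
  have : IsProbabilityMeasure M := ⟨by rw [hMa _ MeasurableSet.univ]; simp [hsum]⟩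
  rw [← hMa E hE]
  congr 1
  refine measure_ext_of_cylinder fun w a => ?_
  induction a with
  | zero =>
    rw [pathLaw_cylinder_zero, hMa _ (measurableSet_forall_le_eq w 0)]
    by_cases hx : x = w 0
    · simpa [hx, consPath] using hsum.symm
    · simp [hx, consPath]
  | succ a ih =>
    have hpre : ∀ b, consPath x ⁻¹' {Z | ∀ i ≤ b + 1, Z i = w i} =
        {Z | x = w 0 ∧ ∀ i ≤ b, Z i = w (i + 1)} := by
      intro b
      ext Z
      simp only [Set.mem_preimage, Set.mem_ofPred_eq]
      constructor
      · intro h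
        exact ⟨h 0 (by omega), fun i hi => h (i + 1) (by omega)⟩
      · rintro ⟨h0, h⟩ i hi
        cases i with
        | zero => exact h0
        | succ i => exact h i (by omega)
    rw [pathLaw_cylinder_succ, ih, hMa _ (measurableSet_forall_le_eq w _),
      hMa _ (measurableSet_forall_le_eq w _), hpre]
    by_cases hx : x = w 0
    · simp only [hx, true_and]
      cases a with
      | zero =>
        have hp : consPath (w 0) ⁻¹' {Z | ∀ i ≤ 0, Z i = w i} = Set.univ := by
          ext Z; simp [consPath]
        have h1 : ∀ y, pathLaw K y {Z | ∀ i ≤ 0, Z i = w (i + 1)} = if y = w 1 then 1 else 0 :=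
          fun y => pathLaw_cylinder_zero K y fun i => w (i + 1)
        rw [hx] at hsum
        rw [hp]
        simp only [h1, measure_univ, mul_one, hsum]
        simp
      | succ a =>
        rw [hx] at hpre
        rw [hpre]
        simp only [true_and, Finset.sum_mul]
        refine Finset.sum_congr rfl fun y _ => ?_
        rw [pathLaw_cylinder_succ K y (fun i => w (i + 1)) a, mul_assoc]
    · simp only [hx, false_and, Set.ofPred_false, measure_empty, mul_zero, Finset.sum_const_zero]
      cases a with
      | zero => simp [consPath, hx]
      | succ a => rw [hpre]; simp [hx]

end Markov

/-! ### Tails and expectations of hitting times -/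

section Survival

variable {Θ : Type u} [Fintype Θ] [DecidableEq Θ]

lemma kernel_nonneg (K : Matrix.rowStochastic ℝ Θ) (x y : Θ) : 0 ≤ K.1 x y :=
  (Matrix.mem_rowStochastic_iff_sum.1 K.2).1 x y

lemma kernel_sum (K : Matrix.rowStochastic ℝ Θ) (x : Θ) : ∑ y, K.1 x y = 1 :=
  (Matrix.mem_rowStochastic_iff_sum.1 K.2).2 x

/-- The probability `P_x[τ_A > t]`, computed by first-step analysis. -/
def surv (K : Matrix.rowStochastic ℝ Θ) (A : Finset Θ) : ℕ → Θ → ℝ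
  | 0 => fun x => if x ∈ A then 0 else 1
  | t + 1 => fun x => if x ∈ A then 0 else ∑ y, K.1 x y * surv K A t y

variable (K : Matrix.rowStochastic ℝ Θ) (A : Finset Θ)

lemma surv_of_mem {x : Θ} (hx : x ∈ A) (t : ℕ) : surv K A t x = 0 := by
  cases t <;> simp [surv, hx]

lemma surv_succ_of_notMem {x : Θ} (hx : x ∉ A) (t : ℕ) :
    surv K A (t + 1) x = ∑ y, K.1 x y * surv K A t y := by
  simp [surv, hx]

lemma surv_nonneg (t : ℕ) (x : Θ) : 0 ≤ surv K A t x := by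
  induction t generalizing x with
  | zero => simp only [surv]; split_ifs <;> norm_num
  | succ t ih =>
    simp only [surv]
    split_ifs
    · exact le_rfl
    · exact Finset.sum_nonneg fun y _ => mul_nonneg (kernel_nonneg K x y) (ih y)

lemma surv_succ_le (t : ℕ) (x : Θ) : surv K A (t + 1) x ≤ surv K A t x := by
  induction t generalizing x with
  | zero =>
    simp only [surv]
    split_ifs
    · exact le_rfl
    · refine le_of_le_of_eq (Finset.sum_le_sum fun y _ => ?_) (kernel_sum K x)
      split_ifs
      · simpa using kernel_nonneg K x y
      · simp
  | succ t ih =>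
    by_cases hx : x ∈ A
    · simp [surv_of_mem K A hx]
    · rw [surv_succ_of_notMem K A hx, surv_succ_of_notMem K A hx]
      exact Finset.sum_le_sum fun y _ => mul_le_mul_of_nonneg_left (ih y) (kernel_nonneg K x y)

lemma surv_antitone (x : Θ) : Antitone fun t => surv K A t x :=
  antitone_nat_of_succ_le fun t => surv_succ_le K A t x

/-- Surviving `s` steps leaves the chain at some state, from which surviving `T` more has
probability at most `p`. The induction peels off the first of the `s` steps. -/
lemma surv_add_le {T : ℕ} {p : ℝ} (h : ∀ x, surv K A T x ≤ p) (s : ℕ) (x : Θ) :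
    surv K A (T + s) x ≤ p * surv K A s x := by
  induction s generalizing x with
  | zero =>
    by_cases hx : x ∈ A
    · simp [surv_of_mem K A hx]
    · simpa [surv, hx] using h x
  | succ s ih =>
    by_cases hx : x ∈ A
    · simp [surv_of_mem K A hx]
    · rw [← add_assoc]
      simp only [surv, hx, if_false]
      rw [Finset.mul_sum]
      refine Finset.sum_le_sum fun y _ => ?_
      nlinarith [mul_le_mul_of_nonneg_left (ih y) (kernel_nonneg K x y)]

lemma surv_le_one (t : ℕ) (x : Θ) : surv K A t x ≤ 1 :=
  (surv_antitone K A x (Nat.zero_le t)).trans (by simp only [surv]; split_ifs <;> norm_num)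

/-- The partial sum `Σ` satisfies `Σ ≤ T + p Σ`: the first `T` terms are at most one, and the
shifted ones are at most `p` times the original ones. -/
lemma sum_surv_le {T : ℕ} {p : ℝ} (hp : p < 1) (h : ∀ x, surv K A T x ≤ p) (N : ℕ) (x : Θ) :
    ∑ s ∈ Finset.range N, surv K A s x ≤ T / (1 - p) := by
  have h1 : ∑ s ∈ Finset.range N, surv K A s x ≤ ∑ s ∈ Finset.range (T + N), surv K A s x :=
    Finset.sum_le_sum_of_subset_of_nonneg (Finset.range_mono (by omega))
      fun s _ _ => surv_nonneg K A s x
  rw [Finset.sum_range_add] at h1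
  have h2 : ∑ s ∈ Finset.range T, surv K A s x ≤ T := by
    simpa using Finset.sum_le_sum fun s (_ : s ∈ Finset.range T) => surv_le_one K A s x
  have h3 : ∑ s ∈ Finset.range N, surv K A (T + s) x ≤
      p * ∑ s ∈ Finset.range N, surv K A s x := by
    rw [Finset.mul_sum]
    exact Finset.sum_le_sum fun s _ => surv_add_le K A h s x
  rw [le_div_iff₀ (by linarith)]
  linarith

lemma tsum_surv_le {T : ℕ} {p : ℝ} (hp : p < 1) (h : ∀ x, surv K A T x ≤ p) (x : Θ) :
    ∑' s, ENNReal.ofReal (surv K A s x) ≤ ENNReal.ofReal (T / (1 - p)) := by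
  refine ENNReal.tsum_le_of_sum_range_le fun N => ?_
  rw [← ENNReal.ofReal_sum_of_nonneg fun s _ => surv_nonneg K A s x]
  exact ENNReal.ofReal_le_ofReal (sum_surv_le K A hp h N x)

/-- Markov's inequality for the hitting time. The factor is `m + 1` because exceeding `m` means
being at least `m + 1`. -/
lemma mul_surv_le_tsum (m : ℕ) (x : Θ) :
    ((m + 1 : ℕ) : ℝ≥0∞) * ENNReal.ofReal (surv K A m x) ≤
      ∑' s, ENNReal.ofReal (surv K A s x) := by
  refine le_trans ?_ (ENNReal.sum_le_tsum (Finset.range (m + 1)))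
  have : ((m + 1 : ℕ) : ℝ≥0∞) * ENNReal.ofReal (surv K A m x) =
      ∑ s ∈ Finset.range (m + 1), ENNReal.ofReal (surv K A m x) := by simp
  rw [this]
  exact Finset.sum_le_sum fun s hs => ENNReal.ofReal_le_ofReal
    (surv_antitone K A x (by have := Finset.mem_range.1 hs; omega))

variable [MeasurableSpace Θ] [DiscreteMeasurableSpace Θ]

omit [Fintype Θ] [DecidableEq Θ] in
lemma measurableSet_coord_mem (s : ℕ) (B : Set Θ) : MeasurableSet {Z : ℕ → Θ | Z s ∈ B} :=
  measurable_pi_apply (X := fun _ : ℕ => Θ) s (MeasurableSet.of_discrete (s := B))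

omit [Fintype Θ] [DecidableEq Θ] in
lemma measurableSet_avoid (t : ℕ) : MeasurableSet {Z : ℕ → Θ | ∀ s ≤ t, Z s ∉ A} := by
  have : {Z : ℕ → Θ | ∀ s ≤ t, Z s ∉ A} = ⋂ s ∈ Set.Iic t, {Z | Z s ∈ ((A : Set Θ)ᶜ)} := by
    ext; simp
  rw [this]
  exact MeasurableSet.biInter (Set.to_countable _) fun i _ => measurableSet_coord_mem i _

lemma pathLaw_start_eq (x : Θ) : ∀ᵐ Z ∂(pathLaw K x), Z 0 = x := by
  rw [ae_iff]
  have h := measurableSet_coord_mem 0 ({x}ᶜ : Set Θ)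
  have := pathLaw_apply K x h
  simpa [consPath] using this

lemma pathLaw_avoid (t : ℕ) (x : Θ) :
    pathLaw K x {Z | ∀ s ≤ t, Z s ∉ A} = ENNReal.ofReal (surv K A t x) := by
  induction t generalizing x with
  | zero =>
    rw [pathLaw_apply K x (measurableSet_avoid A 0)]
    have h : consPath x ⁻¹' {Z | ∀ s ≤ 0, Z s ∉ A} = {_Z | x ∉ A} := by
      ext Z; simp [consPath]
    rw [h]
    by_cases hx : x ∈ A
    · simp [surv, hx]
    · simp only [hx, not_false_eq_true, Set.ofPred_true, measure_univ, mul_one, surv, if_false]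
      rw [← ENNReal.ofReal_sum_of_nonneg fun y _ => kernel_nonneg K x y, kernel_sum]
  | succ t ih =>
    rw [pathLaw_apply K x (measurableSet_avoid A _)]
    have h : consPath x ⁻¹' {Z | ∀ s ≤ t + 1, Z s ∉ A} = {Z | x ∉ A ∧ ∀ s ≤ t, Z s ∉ A} := by
      ext Z
      simp only [Set.mem_preimage, Set.mem_ofPred_eq]
      constructor
      · intro h
        exact ⟨h 0 (by omega), fun i hi => h (i + 1) (by omega)⟩
      · rintro ⟨h0, h⟩ i hi
        cases i with
        | zero => exact h0
        | succ i => exact h i (by omega)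
    rw [h]
    by_cases hx : x ∈ A
    · simp [surv, hx]
    · simp only [hx, not_false_eq_true, true_and, surv, if_false, ih]
      rw [ENNReal.ofReal_sum_of_nonneg fun y _ =>
        mul_nonneg (kernel_nonneg K x y) (surv_nonneg K A t y)]
      exact Finset.sum_congr rfl fun y _ => (ENNReal.ofReal_mul (kernel_nonneg K x y)).symm

omit [Fintype Θ] [MeasurableSpace Θ] [DiscreteMeasurableSpace Θ] in
lemma hittingTime_eq_tsum (Z : ℕ → Θ) :
    hittingTime A Z = ∑' t : ℕ, {Z : ℕ → Θ | ∀ s ≤ t, Z s ∉ A}.indicator 1 Z := by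
  classical
  by_cases h : ∃ t, Z t ∈ A
  · have h1 : hittingTime A Z = (Nat.find h : ℝ≥0∞) := by
      refine le_antisymm (iInf₂_le (Nat.find h) (Nat.find_spec h)) (le_iInf₂ fun t ht => ?_)
      exact_mod_cast Nat.find_min' h ht
    rw [h1, tsum_eq_sum (s := Finset.range (Nat.find h))]
    · rw [Finset.sum_congr rfl (g := fun _ => (1 : ℝ≥0∞))]
      · simp
      · intro t ht
        rw [Set.indicator_of_mem]
        · rfl
        · intro s hs
          exact Nat.find_min h (by have := Finset.mem_range.1 ht; omega)
    · intro t ht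
      rw [Set.indicator_of_notMem]
      intro h'
      exact h' (Nat.find h) (by simpa using ht) (Nat.find_spec h)
  · push Not at h
    have h1 : hittingTime A Z = ⊤ := by
      simp [hittingTime, h]
    have h2 : ∀ t : ℕ, {Z : ℕ → Θ | ∀ s ≤ t, Z s ∉ A}.indicator (1 : (ℕ → Θ) → ℝ≥0∞) Z = 1 := by
      intro t
      rw [Set.indicator_of_mem]
      · rfl
      · exact fun s _ => h s
    simp only [h1, h2]
    exact (ENNReal.tsum_const_eq_top_of_ne_zero one_ne_zero).symm

lemma lintegral_hittingTime (x : Θ) :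
    ∫⁻ Z, hittingTime A Z ∂(pathLaw K x) = ∑' t, ENNReal.ofReal (surv K A t x) := by
  simp_rw [hittingTime_eq_tsum]
  rw [lintegral_tsum fun t =>
    (measurable_one.indicator (measurableSet_avoid A t)).aemeasurable]
  refine tsum_congr fun t => ?_
  rw [lintegral_indicator_one (measurableSet_avoid A t), pathLaw_avoid]

end Survival

/-! ### Hitting times bounded by mixing times -/

section MixingTime

variable {Θ : Type u} [Fintype Θ] [DecidableEq Θ]

omit [DecidableEq Θ] in
lemma sum_sub_le_tvDist (μ ν : Θ → ℝ) (A : Finset Θ) :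
    ∑ x ∈ A, μ x - ∑ x ∈ A, ν x ≤ tvDist μ ν :=
  le_ciSup (f := fun A : Finset Θ => ∑ x ∈ A, μ x - ∑ x ∈ A, ν x)
    (Set.finite_range _).bddAbove A

omit [DecidableEq Θ] in
-- Since the total masses agree, `f` may be shifted by `lo`; discarding the states where `μ ≤ ν`
-- then leaves `hi - lo` times the excess mass on a single set.
lemma sum_mul_sub_le_tvDist {μ ν f : Θ → ℝ} {lo hi : ℝ} (h : ∑ x, μ x = ∑ x, ν x)
    (hlo : ∀ x, lo ≤ f x) (hhi : ∀ x, f x ≤ hi) (hle : lo ≤ hi) :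
    ∑ x, μ x * f x - ∑ x, ν x * f x ≤ (hi - lo) * tvDist μ ν := by
  set A : Finset Θ := Finset.univ.filter fun x => ν x < μ x
  have h1 : ∑ x, μ x * f x - ∑ x, ν x * f x = ∑ x, (μ x - ν x) * (f x - lo) := by
    simp only [sub_mul, mul_sub, Finset.sum_sub_distrib, ← Finset.sum_mul, h]
    ring
  have h2 : ∑ x, (μ x - ν x) * (f x - lo) ≤ ∑ x ∈ A, (hi - lo) * (μ x - ν x) := by
    rw [← Finset.sum_filter_add_sum_filter_not Finset.univ (fun x => ν x < μ x)]
    have h3 : ∑ x ∈ Finset.univ.filter (fun x => ¬ ν x < μ x), (μ x - ν x) * (f x - lo) ≤ 0 :=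
      Finset.sum_nonpos fun x hx => mul_nonpos_of_nonpos_of_nonneg
        (by have := (Finset.mem_filter.1 hx).2; linarith) (by linarith [hlo x])
    have h4 : ∑ x ∈ Finset.univ.filter (fun x => ν x < μ x), (μ x - ν x) * (f x - lo) ≤
        ∑ x ∈ A, (hi - lo) * (μ x - ν x) := by
      refine Finset.sum_le_sum fun x hx => ?_
      have := (Finset.mem_filter.1 hx).2
      nlinarith [hhi x]
    linarith
  rw [h1]
  refine h2.trans ?_
  rw [← Finset.mul_sum, Finset.sum_sub_distrib]
  exact mul_le_mul_of_nonneg_left (sum_sub_le_tvDist μ ν A) (by linarith)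

lemma mixingTime_cases (K : Matrix Θ Θ ℝ) (π : Θ → ℝ) :
    mixingTime K π = ⊤ ∨ ∃ t : ℕ, 0 < t ∧ (∀ x, tvDist ((K ^ t) x) π < 1 / 4) ∧
      mixingTime K π = t := by
  classical
  by_cases h : ∃ t : ℕ, 0 < t ∧ ∀ x, tvDist ((K ^ t) x) π < 1 / 4
  · refine Or.inr ⟨Nat.find h, (Nat.find_spec h).1, (Nat.find_spec h).2, ?_⟩
    refine le_antisymm (iInf₂_le (Nat.find h) (Nat.find_spec h)) (le_iInf₂ fun t ht => ?_)
    exact_mod_cast Nat.find_min' h ht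
  · refine Or.inl ?_
    push Not at h
    refine iInf₂_eq_top.2 fun t ht => ?_
    obtain ⟨x, hx⟩ := h t ht.1
    exact absurd (ht.2 x) (not_lt.2 hx)

lemma mixingTime_le {K : Matrix Θ Θ ℝ} {π : Θ → ℝ} {t : ℕ} (ht : 0 < t)
    (h : ∀ x, tvDist ((K ^ t) x) π < 1 / 4) : mixingTime K π ≤ t :=
  iInf₂_le t ⟨ht, h⟩

lemma one_le_mixingTime (K : Matrix Θ Θ ℝ) (π : Θ → ℝ) : 1 ≤ mixingTime K π :=
  le_iInf₂ fun t ht => by exact_mod_cast ht.1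

variable (K : rowStochastic ℝ Θ)

lemma pow_nonneg_entry (t : ℕ) (x y : Θ) : 0 ≤ (K.1 ^ t) x y :=
  kernel_nonneg (K ^ t) x y

lemma pow_row_sum (t : ℕ) (x : Θ) : ∑ y, (K.1 ^ t) x y = 1 :=
  kernel_sum (K ^ t) x

lemma mulVec_mono {f g : Θ → ℝ} (h : ∀ x, f x ≤ g x) (x : Θ) :
    (K.1 *ᵥ f) x ≤ (K.1 *ᵥ g) x :=
  Finset.sum_le_sum fun y _ => mul_le_mul_of_nonneg_left (h y) (kernel_nonneg K x y)

lemma pow_mulVec_succ (t : ℕ) (f : Θ → ℝ) : K.1 ^ (t + 1) *ᵥ f = K.1 *ᵥ (K.1 ^ t *ᵥ f) := by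
  rw [mulVec_mulVec, pow_succ']

lemma surv_le_pow_mulVec (A : Finset Θ) (t : ℕ) (x : Θ) :
    surv K A t x ≤ (K.1 ^ t *ᵥ surv K A 0) x := by
  induction t generalizing x with
  | zero => simp
  | succ t ih =>
    rw [pow_mulVec_succ]
    have h : (K.1 *ᵥ surv K A t) x ≤ (K.1 *ᵥ (K.1 ^ t *ᵥ surv K A 0)) x := mulVec_mono K ih x
    by_cases hx : x ∈ A
    · rw [surv_of_mem K A hx]
      exact le_trans (Finset.sum_nonneg fun y _ =>
        mul_nonneg (kernel_nonneg K x y) (surv_nonneg K A t y)) h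
    · rw [surv_succ_of_notMem K A hx]
      exact h

variable {K} {π : Θ → ℝ}

lemma IsLazyReversible.sum_eq_one (h : IsLazyReversible K π) : ∑ x, π x = 1 := h.prob.2

lemma IsLazyReversible.nonneg (h : IsLazyReversible K π) (x : Θ) : 0 ≤ π x := h.prob.1 x

lemma IsLazyReversible.sum_mulVec (h : IsLazyReversible K π) (f : Θ → ℝ) :
    ∑ x, π x * (K.1 *ᵥ f) x = ∑ x, π x * f x := by
  simp only [mulVec, dotProduct, Finset.mul_sum]
  rw [Finset.sum_comm]
  refine Finset.sum_congr rfl fun y _ => ?_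
  rw [Finset.sum_congr rfl (g := fun x => K.1 y x * (π y * f y))
    fun x _ => by rw [← mul_assoc, h.detailed_balance x y]; ring]
  rw [← Finset.sum_mul, kernel_sum, one_mul]

lemma IsLazyReversible.sum_pow_mulVec (h : IsLazyReversible K π) (t : ℕ) (f : Θ → ℝ) :
    ∑ x, π x * (K.1 ^ t *ᵥ f) x = ∑ x, π x * f x := by
  induction t with
  | zero => simp
  | succ t ih => rw [pow_mulVec_succ, h.sum_mulVec, ih]

/-- Some state carries mass, and by irreducibility an iterate of the chain, which preserves `π`,
transports part of it to `y`. -/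
lemma IsLazyReversible.pos (h : IsLazyReversible K π) (y : Θ) : 0 < π y := by
  have hex : ∃ x, 0 < π x := by
    by_contra hne
    push Not at hne
    have := Finset.sum_nonpos fun x (_ : x ∈ Finset.univ) => hne x
    rw [h.sum_eq_one] at this
    linarith
  obtain ⟨x, hx⟩ := hex
  obtain ⟨k, -, hk⟩ := (isIrreducible_iff_exists_pow_pos (kernel_nonneg K)).1 h.irreducible x y
  have h1 := h.sum_pow_mulVec k (Pi.single y 1)
  simp only [mulVec_single_one, col_apply, Pi.single_apply, mul_ite, mul_one, mul_zero,
    Finset.sum_ite_eq', Finset.mem_univ, if_true] at h1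
  rw [← h1]
  exact Finset.sum_pos' (fun z _ => mul_nonneg (h.nonneg z) (pow_nonneg_entry K k z y))
    ⟨x, Finset.mem_univ x, mul_pos hx hk⟩

/-- Once the total variation distance is below `1/4`, iteration halves oscillations. -/
lemma IsLazyReversible.exists_osc_bound (h : IsLazyReversible K π) {t : ℕ}
    (ht : ∀ x, tvDist ((K.1 ^ t) x) π < 1 / 4) {f : Θ → ℝ} (h0 : ∀ x, 0 ≤ f x)
    (h1 : ∀ x, f x ≤ 1) (m : ℕ) :
    ∃ lo : ℝ, ∀ x, lo ≤ (K.1 ^ (t * m) *ᵥ f) x ∧ (K.1 ^ (t * m) *ᵥ f) x ≤ lo + (1 / 2) ^ m := by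
  induction m with
  | zero => exact ⟨0, fun x => by simpa using ⟨h0 x, h1 x⟩⟩
  | succ m ih =>
    obtain ⟨lo, hlo⟩ := ih
    set g := K.1 ^ (t * m) *ᵥ f with hg
    have he : K.1 ^ (t * (m + 1)) *ᵥ f = K.1 ^ t *ᵥ g := by
      rw [hg, mulVec_mulVec, ← pow_add]
      congr 2
      ring
    have hp : (0 : ℝ) < (1 / 2) ^ m := by positivity
    have hs : ∀ x, ∑ y, (K.1 ^ t) x y = ∑ y, π y := fun x => by
      rw [pow_row_sum, h.sum_eq_one]
    -- Oscillation at most `(1 / 2) ^ m` and distance below `1/4` put every value of `K ^ t g`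
    -- within `(1 / 2) ^ m / 4` of the mean. The bounds for `g` and `-g` give the two sides.
    refine ⟨∑ x, π x * g x - (1 / 2) ^ m / 4, fun x => ?_⟩
    have a1 := sum_mul_sub_le_tvDist (hs x) (fun y => (hlo y).1) (fun y => (hlo y).2)
      (by linarith)
    have a2 := sum_mul_sub_le_tvDist (f := fun y => - g y) (hs x)
      (fun y => neg_le_neg (hlo y).2) (fun y => neg_le_neg (hlo y).1) (by linarith)
    simp only [mul_neg, Finset.sum_neg_distrib] at a2
    rw [he]
    have e : (K.1 ^ t *ᵥ g) x = ∑ y, (K.1 ^ t) x y * g y := rfl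
    rw [e, pow_succ]
    have hx := ht x
    constructor <;> nlinarith

variable [MeasurableSpace Θ] [DiscreteMeasurableSpace Θ]

/-- After `t m` steps the tail is at most its stationary mean `1 - α` plus an oscillation of at most
`α / 2`. This gives `2 t m / α`; writing `m + 1` for `m` keeps the constant visibly positive. -/
lemma IsLazyReversible.maxHittingTime_le (h : IsLazyReversible K π) {α : ℝ} (hα : 0 < α) {m : ℕ}
    (hm : ((1 : ℝ) / 2) ^ m ≤ α / 2) :
    maxHittingTime K π α ≤ ENNReal.ofReal (2 * (m + 1) / α) * mixingTime K.1 π := by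
  rcases mixingTime_cases K.1 π with ht | ⟨t, htpos, ht, heq⟩
  · rw [ht, ENNReal.mul_top]
    · exact le_top
    · exact (ENNReal.ofReal_pos.2 (by positivity)).ne'
  rw [heq]
  refine iSup_le fun x => iSup₂_le fun A hA => ?_
  rw [lintegral_hittingTime]
  have hmean : ∑ y, π y * surv K A 0 y ≤ 1 - α := by
    have h1 : ∑ y, π y * surv K A 0 y = ∑ y, π y - ∑ y ∈ A, π y := by
      rw [← Finset.sum_filter_add_sum_filter_not Finset.univ (fun y => y ∈ A)
        (fun y => π y)]
      simp [surv, Finset.sum_ite]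
    rw [h1, h.sum_eq_one]
    linarith
  have hs : ∀ y, surv K A (t * m) y ≤ 1 - α / 2 := by
    intro y
    refine (surv_le_pow_mulVec K A _ y).trans ?_
    obtain ⟨lo, hlo⟩ := h.exists_osc_bound ht (surv_nonneg K A 0) (surv_le_one K A 0) m
    have hl : lo ≤ 1 - α := by
      refine le_trans ?_ hmean
      rw [← h.sum_pow_mulVec (t * m), ← one_mul lo, ← h.sum_eq_one, Finset.sum_mul]
      exact Finset.sum_le_sum fun z _ => mul_le_mul_of_nonneg_left (hlo z).1 (h.nonneg z)
    linarith [(hlo y).2]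
  refine (tsum_surv_le K A (by linarith) hs x).trans ?_
  have : ((t : ℕ) : ℝ≥0∞) = ENNReal.ofReal t := by simp
  rw [this, ← ENNReal.ofReal_mul (by positivity)]
  refine ENNReal.ofReal_le_ofReal ?_
  push_cast
  rw [div_le_iff₀ (by linarith)]
  have e : 2 * ((m : ℝ) + 1) / α * t * (1 - (1 - α / 2)) = (m + 1) * t := by
    field_simp
    ring
  rw [e]
  nlinarith [(Nat.cast_nonneg t : (0 : ℝ) ≤ t)]

end MixingTime

lemma exists_isLowerConstant {α : ℝ} (hα : 0 < α) : ∃ c', IsLowerConstant.{u} α c' := by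
  obtain ⟨m, hm⟩ := exists_pow_lt_of_lt_one (half_pos hα) (by norm_num : (1 : ℝ) / 2 < 1)
  exact ⟨2 * (m + 1) / α, by positivity, fun S _ _ _ _ _ K π h => h.maxHittingTime_le hα hm.le⟩

/-! ### Dirichlet form and autocorrelations -/

section Dirichlet

variable {Θ : Type u} [Fintype Θ] [DecidableEq Θ]

/-- The inner product weighted by `π`. -/
def wip (π f g : Θ → ℝ) : ℝ := ∑ x, π x * (f x * g x)

omit [DecidableEq Θ] in
lemma wip_comm (π f g : Θ → ℝ) : wip π f g = wip π g f :=
  Finset.sum_congr rfl fun x _ => by ring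

omit [DecidableEq Θ] in
lemma wip_sub_left (π f g k : Θ → ℝ) : wip π (f - g) k = wip π f k - wip π g k := by
  simp only [wip, ← Finset.sum_sub_distrib, Pi.sub_apply]
  exact Finset.sum_congr rfl fun x _ => by ring

omit [DecidableEq Θ] in
lemma wip_sub_right (π f g k : Θ → ℝ) : wip π k (f - g) = wip π k f - wip π k g := by
  rw [wip_comm, wip_sub_left, wip_comm, wip_comm π g]

variable {K : rowStochastic ℝ Θ} {π : Θ → ℝ}

lemma IsLazyReversible.wip_self_nonneg (h : IsLazyReversible K π) (f : Θ → ℝ) :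
    0 ≤ wip π f f :=
  Finset.sum_nonneg fun x _ => mul_nonneg (h.nonneg x) (mul_self_nonneg _)

lemma sum_sum_left (K : rowStochastic ℝ Θ) (π f : Θ → ℝ) :
    ∑ x, ∑ y, π x * K.1 x y * f x = ∑ x, π x * f x := by
  refine Finset.sum_congr rfl fun x _ => ?_
  rw [← Finset.sum_mul, ← Finset.mul_sum, kernel_sum, mul_one]

lemma IsLazyReversible.sum_sum_right (h : IsLazyReversible K π) (f : Θ → ℝ) :
    ∑ x, ∑ y, π x * K.1 x y * f y = ∑ x, π x * f x := by
  rw [Finset.sum_comm, ← sum_sum_left K]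
  refine Finset.sum_congr rfl fun x _ => Finset.sum_congr rfl fun y _ => ?_
  rw [h.detailed_balance]

lemma sum_sum_cross (K : rowStochastic ℝ Θ) (π f g : Θ → ℝ) :
    ∑ x, ∑ y, π x * K.1 x y * (f x * g y) = wip π f (K.1 *ᵥ g) := by
  refine Finset.sum_congr rfl fun x _ => ?_
  simp only [mulVec, dotProduct, Finset.mul_sum]
  exact Finset.sum_congr rfl fun y _ => by ring

lemma IsLazyReversible.wip_mulVec (h : IsLazyReversible K π) (f g : Θ → ℝ) :
    wip π f (K.1 *ᵥ g) = wip π (K.1 *ᵥ f) g := by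
  rw [wip_comm π (K.1 *ᵥ f), ← sum_sum_cross, ← sum_sum_cross, Finset.sum_comm]
  refine Finset.sum_congr rfl fun x _ => Finset.sum_congr rfl fun y _ => ?_
  rw [h.detailed_balance]
  ring

/-- The Dirichlet form as a sum over pairs of states. -/
lemma IsLazyReversible.sum_sum_sub_mul_sub (h : IsLazyReversible K π) (f g : Θ → ℝ) :
    ∑ x, ∑ y, π x * K.1 x y * ((f x - f y) * (g x - g y)) =
      2 * (wip π f g - wip π f (K.1 *ᵥ g)) := by
  have e : ∀ x y, π x * K.1 x y * ((f x - f y) * (g x - g y)) =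
      π x * K.1 x y * (f x * g x) + π x * K.1 x y * (f y * g y) -
        π x * K.1 x y * (f x * g y) - π x * K.1 x y * (g x * f y) := fun x y => by ring
  simp only [e, Finset.sum_add_distrib, Finset.sum_sub_distrib]
  rw [sum_sum_cross, sum_sum_cross, sum_sum_left K π (fun x => f x * g x),
    h.sum_sum_right (fun x => f x * g x), h.wip_mulVec g f, wip_comm π (K.1 *ᵥ g)]
  simp only [wip]
  ring

lemma IsLazyReversible.wip_mulVec_le (h : IsLazyReversible K π) (f : Θ → ℝ) :
    wip π f (K.1 *ᵥ f) ≤ wip π f f := by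
  have h1 := h.sum_sum_sub_mul_sub f f
  have h2 : 0 ≤ ∑ x, ∑ y, π x * K.1 x y * ((f x - f y) * (f x - f y)) :=
    Finset.sum_nonneg fun x _ => Finset.sum_nonneg fun y _ =>
      mul_nonneg (mul_nonneg (h.nonneg x) (kernel_nonneg K x y)) (mul_self_nonneg _)
  linarith

/-- Laziness makes the transition operator positive semidefinite. -/
lemma IsLazyReversible.wip_mulVec_nonneg (h : IsLazyReversible K π) (f : Θ → ℝ) :
    0 ≤ wip π f (K.1 *ᵥ f) := by
  have e : ∀ x y, π x * K.1 x y * (f x + f y) ^ 2 =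
      π x * K.1 x y * (f x * f x) + π x * K.1 x y * (f y * f y) +
        2 * (π x * K.1 x y * (f x * f y)) := fun x y => by ring
  have h1 : ∑ x, ∑ y, π x * K.1 x y * (f x + f y) ^ 2 =
      2 * wip π f f + 2 * wip π f (K.1 *ᵥ f) := by
    simp only [e, Finset.sum_add_distrib, ← Finset.mul_sum]
    rw [sum_sum_cross, sum_sum_left K π (fun x => f x * f x),
      h.sum_sum_right (fun x => f x * f x)]
    simp only [wip]
    ring
  have h2 : 2 * wip π f f ≤ ∑ x, ∑ y, π x * K.1 x y * (f x + f y) ^ 2 := by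
    rw [wip, Finset.mul_sum]
    refine Finset.sum_le_sum fun x _ => ?_
    refine le_trans ?_ (Finset.single_le_sum (f := fun y => π x * K.1 x y * (f x + f y) ^ 2)
      (fun y _ => mul_nonneg (mul_nonneg (h.nonneg x) (kernel_nonneg K x y)) (sq_nonneg _))
      (Finset.mem_univ x))
    have := mul_le_mul_of_nonneg_right (mul_le_mul_of_nonneg_left (h.lazy x) (h.nonneg x))
      (sq_nonneg (f x + f x))
    linarith
  linarith

/-- The autocorrelations `⟨f, K ^ s f⟩`. -/
def autocorr (K : rowStochastic ℝ Θ) (π f : Θ → ℝ) (s : ℕ) : ℝ := wip π f (K.1 ^ s *ᵥ f)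

/-- By self-adjointness, powers can be moved from one side of the inner product to the other. -/
lemma IsLazyReversible.wip_pow_pow (h : IsLazyReversible K π) (f : Θ → ℝ) (i j : ℕ) :
    wip π (K.1 ^ i *ᵥ f) (K.1 ^ j *ᵥ f) = autocorr K π f (i + j) := by
  induction i generalizing j with
  | zero => simp [autocorr]
  | succ i ih =>
    rw [pow_mulVec_succ, ← h.wip_mulVec, ← pow_mulVec_succ, ih, ← add_assoc, add_right_comm]

/-- Even lags are squared norms; odd lags are values of the quadratic form of `K`, which laziness
makes nonnegative. -/
lemma IsLazyReversible.autocorr_nonneg (h : IsLazyReversible K π) (f : Θ → ℝ) (s : ℕ) :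
    0 ≤ autocorr K π f s := by
  rcases Nat.even_or_odd' s with ⟨j, rfl | rfl⟩
  · rw [two_mul, ← h.wip_pow_pow]
    exact h.wip_self_nonneg _
  · rw [two_mul, add_assoc, ← h.wip_pow_pow, pow_mulVec_succ]
    exact h.wip_mulVec_nonneg _

lemma IsLazyReversible.wip_pow_sub (h : IsLazyReversible K π) (f : Θ → ℝ) (i j : ℕ) :
    wip π (K.1 ^ i *ᵥ (f - K.1 *ᵥ f)) (K.1 ^ j *ᵥ (f - K.1 *ᵥ f)) =
      autocorr K π f (i + j) - autocorr K π f (i + j + 1) -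
        (autocorr K π f (i + j + 1) - autocorr K π f (i + j + 2)) := by
  have e : ∀ i, K.1 ^ i *ᵥ (f - K.1 *ᵥ f) = K.1 ^ i *ᵥ f - K.1 ^ (i + 1) *ᵥ f := fun i => by
    rw [mulVec_sub, mulVec_mulVec, pow_succ]
  rw [e, e, wip_sub_left, wip_sub_right, wip_sub_right, h.wip_pow_pow, h.wip_pow_pow,
    h.wip_pow_pow, h.wip_pow_pow, show i + (j + 1) = i + j + 1 by ring,
    show i + 1 + j = i + j + 1 by ring, show i + 1 + (j + 1) = i + j + 2 by ring]

/-- The second difference at lag `s` is the autocorrelation of `f - K f` at lag `s`, hence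
nonnegative by the same parity split. -/
lemma IsLazyReversible.autocorr_convex (h : IsLazyReversible K π) (f : Θ → ℝ) (s : ℕ) :
    autocorr K π f (s + 1) - autocorr K π f (s + 2) ≤
      autocorr K π f s - autocorr K π f (s + 1) := by
  rcases Nat.even_or_odd' s with ⟨j, rfl | rfl⟩
  · have h1 := h.wip_pow_sub f j j
    have h2 := h.wip_self_nonneg (K.1 ^ j *ᵥ (f - K.1 *ᵥ f))
    rw [two_mul]
    linarith
  · have h1 := h.wip_pow_sub f j (j + 1)
    have h2 := h.wip_mulVec_nonneg (K.1 ^ j *ᵥ (f - K.1 *ᵥ f))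
    rw [← pow_mulVec_succ] at h2
    rw [two_mul, add_assoc j j 1]
    linarith

lemma IsLazyReversible.autocorr_drop_antitone (h : IsLazyReversible K π) (f : Θ → ℝ) :
    Antitone fun s => autocorr K π f s - autocorr K π f (s + 1) :=
  antitone_nat_of_succ_le fun s => h.autocorr_convex f s

/-- The drops decrease, so `s + 1` copies of the drop at `s` are bounded by a telescoping sum,
itself at most the value at lag zero. No spectral gap enters. -/
lemma IsLazyReversible.mul_autocorr_drop_le (h : IsLazyReversible K π) (f : Θ → ℝ) (s : ℕ) :
    (s + 1) * (autocorr K π f s - autocorr K π f (s + 1)) ≤ wip π f f := by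
  have h1 : ∑ r ∈ Finset.range (s + 1), (autocorr K π f s - autocorr K π f (s + 1)) ≤
      ∑ r ∈ Finset.range (s + 1), (autocorr K π f r - autocorr K π f (r + 1)) :=
    Finset.sum_le_sum fun r hr => h.autocorr_drop_antitone f
      (Nat.lt_succ_iff.1 (Finset.mem_range.1 hr))
  rw [Finset.sum_range_sub', Finset.sum_const, Finset.card_range, nsmul_eq_mul] at h1
  have h2 := h.autocorr_nonneg f (s + 1)
  have h3 : autocorr K π f 0 = wip π f f := by simp [autocorr]
  rw [h3] at h1
  push_cast at h1
  linarith

lemma IsLazyReversible.autocorr_drop_nonneg (h : IsLazyReversible K π) (f : Θ → ℝ) (j : ℕ) :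
    0 ≤ autocorr K π f (2 * j) - autocorr K π f (2 * j + 1) := by
  rw [two_mul, add_assoc, ← h.wip_pow_pow, ← h.wip_pow_pow, pow_mulVec_succ]
  exact sub_nonneg.2 (h.wip_mulVec_le _)

/-- The increments `K ^ s f - K ^ (s + 1) f` are square summable with a rate. -/
lemma IsLazyReversible.sum_wip_increment_le (h : IsLazyReversible K π) (f : Θ → ℝ) (s H : ℕ) :
    (2 * s + 1) * ∑ j ∈ Finset.range H,
      wip π (K.1 ^ (s + j) *ᵥ (f - K.1 *ᵥ f)) (K.1 ^ (s + j) *ᵥ (f - K.1 *ᵥ f)) ≤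
      wip π f f := by
  have h1 : ∑ j ∈ Finset.range H,
      -- Each squared increment is a difference of consecutive drops; enlarging it by convexity to a
      -- difference of drops two lags apart makes the sum telescope.
      wip π (K.1 ^ (s + j) *ᵥ (f - K.1 *ᵥ f)) (K.1 ^ (s + j) *ᵥ (f - K.1 *ᵥ f)) ≤
      autocorr K π f (2 * s) - autocorr K π f (2 * s + 1) -
        (autocorr K π f (2 * (s + H)) - autocorr K π f (2 * (s + H) + 1)) := by
    induction H with
    | zero => simp
    | succ H ih =>
      rw [Finset.sum_range_succ]
      have h2 := h.wip_pow_sub f (s + H) (s + H)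
      have h3 := h.autocorr_convex f (2 * (s + H) + 1)
      rw [← two_mul] at h2
      rw [show 2 * (s + (H + 1)) = 2 * (s + H) + 2 by ring]
      linarith
  have h4 := h.autocorr_drop_nonneg f (s + H)
  have h5 := h.mul_autocorr_drop_le f (2 * s)
  push_cast at h5
  refine le_trans ?_ h5
  exact mul_le_mul_of_nonneg_left (by linarith) (by positivity)

end Dirichlet

/-! ### Poincaré inequality from hitting times -/

section Poincare

variable {Θ : Type u} [Fintype Θ] [DecidableEq Θ] {K : rowStochastic ℝ Θ} {π : Θ → ℝ}

/-- The expected hitting time of `A` solves the Poisson equation. -/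
lemma exists_expected_hitting (A : Finset Θ) {T : ℝ}
    (hT : ∀ x N, ∑ s ∈ Finset.range N, surv K A s x ≤ T) :
    ∃ h : Θ → ℝ, (∀ x, 0 ≤ h x) ∧ (∀ x, h x ≤ T) ∧ (∀ x ∉ A, h x = 1 + (K.1 *ᵥ h) x) := by
  have hsum : ∀ x, Summable fun s => surv K A s x := fun x =>
    summable_of_sum_range_le (fun s => surv_nonneg K A s x) (hT x)
  refine ⟨fun x => ∑' s, surv K A s x, fun x => tsum_nonneg fun s => surv_nonneg K A s x,
    fun x => Real.tsum_le_of_sum_range_le (fun s => surv_nonneg K A s x) (hT x), fun x hx => ?_⟩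
  change ∑' s, surv K A s x = _
  rw [(hsum x).tsum_eq_zero_add]
  congr 1
  · simp [surv, hx]
  · simp_rw [surv_succ_of_notMem K A hx]
    rw [Summable.tsum_finsetSum fun y _ => (hsum y).mul_left _]
    exact Finset.sum_congr rfl fun y _ => tsum_mul_left

/-- A Dirichlet eigenvalue bound in terms of expected hitting times. -/
lemma IsLazyReversible.wip_le_of_eq_zero (h : IsLazyReversible K π) (A : Finset Θ) {T : ℝ}
    (hTpos : 0 < T) (hT : ∀ x N, ∑ s ∈ Finset.range N, surv K A s x ≤ T) (g : Θ → ℝ)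
    (hg : ∀ x ∈ A, g x = 0) :
    wip π g g ≤ T * (wip π g g - wip π g (K.1 *ᵥ g)) := by
  obtain ⟨k, k0, kT, hk⟩ := exists_expected_hitting A hT
  have kpos : ∀ x ∉ A, 1 ≤ k x := fun x hx => by
    rw [hk x hx]
    have : 0 ≤ (K.1 *ᵥ k) x :=
      Finset.sum_nonneg fun y _ => mul_nonneg (kernel_nonneg K x y) (k0 y)
    linarith
  -- Testing the Poisson equation, `k - K k = 1` off `A`, against `g² / k` recovers `∑ π g² / k`,
  -- which dominates `wip π g g / T`. On `A` both `g` and `q` vanish, so zeros of `k` there are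
  -- harmless.
  set q : Θ → ℝ := fun x => g x ^ 2 / k x with hq
  have q0 : ∀ x, 0 ≤ q x := fun x => div_nonneg (sq_nonneg _) (k0 x)
  have qk : ∀ x, q x * k x = g x ^ 2 := fun x => by
    by_cases hx : x ∈ A
    · simp [hq, hg x hx]
    · exact div_mul_cancel₀ _ (by linarith [kpos x hx])
  -- Expanded, this is `2 g(x) g(y) ≤ q(x) k(y) + q(y) k(x)`: the arithmetic-geometric mean
  -- inequality, since `q k = g²`.
  have hpt : ∀ x y, (q x - q y) * (k x - k y) ≤ (g x - g y) * (g x - g y) := by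
    intro x y
    have hamgm : 2 * (g x * g y) ≤ q x * k y + q y * k x := by
      refine le_of_abs_le (abs_le_of_sq_le_sq ?_
        (add_nonneg (mul_nonneg (q0 x) (k0 y)) (mul_nonneg (q0 y) (k0 x))))
      have : (2 * (g x * g y)) ^ 2 = 4 * ((q x * k x) * (q y * k y)) := by
        rw [qk, qk]; ring
      rw [this]
      nlinarith [sq_nonneg (q x * k y - q y * k x)]
    nlinarith [qk x, qk y]
  have h1 : ∑ x, ∑ y, π x * K.1 x y * ((q x - q y) * (k x - k y)) ≤
      ∑ x, ∑ y, π x * K.1 x y * ((g x - g y) * (g x - g y)) :=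
    Finset.sum_le_sum fun x _ => Finset.sum_le_sum fun y _ =>
      mul_le_mul_of_nonneg_left (hpt x y) (mul_nonneg (h.nonneg x) (kernel_nonneg K x y))
  rw [h.sum_sum_sub_mul_sub, h.sum_sum_sub_mul_sub] at h1
  have h2 : wip π g g ≤ T * (wip π q k - wip π q (K.1 *ᵥ k)) := by
    rw [← wip_sub_right, wip, wip, Finset.mul_sum]
    refine Finset.sum_le_sum fun x _ => ?_
    by_cases hx : x ∈ A
    · simp [hq, hg x hx]
    · have e : (k - K.1 *ᵥ k) x = 1 := by
        rw [Pi.sub_apply, hk x hx]; ring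
      rw [e, mul_one, ← sq, ← qk x]
      have := mul_le_mul_of_nonneg_left (kT x) (mul_nonneg (h.nonneg x) (q0 x))
      linarith
  refine h2.trans (mul_le_mul_of_nonneg_left (by linarith) hTpos.le)

omit [DecidableEq Θ] in
lemma exists_median (hπ : ∀ x, 0 ≤ π x) (hsum : ∑ x, π x = 1) (f : Θ → ℝ) :
    ∃ m : ℝ, 1 / 2 ≤ ∑ x ∈ Finset.univ.filter (fun x => f x ≤ m), π x ∧
      1 / 2 ≤ ∑ x ∈ Finset.univ.filter (fun x => m ≤ f x), π x := by
  have hne : (Finset.univ : Finset Θ).Nonempty := by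
    by_contra h
    rw [Finset.not_nonempty_iff_eq_empty] at h
    simp [h] at hsum
  -- The median is the smallest attained value whose sublevel set has mass at least one half. If the
  -- strict sublevel set had mass above one half, its largest value would be a smaller candidate.
  set S := Finset.univ.filter fun z =>
    1 / 2 ≤ ∑ x ∈ Finset.univ.filter (fun x => f x ≤ f z), π x with hS
  have hSne : S.Nonempty := by
    obtain ⟨z, -, hz⟩ := Finset.exists_max_image Finset.univ f hne
    refine ⟨z, Finset.mem_filter.2 ⟨Finset.mem_univ z, ?_⟩⟩
    rw [Finset.filter_true_of_mem fun x hx => hz x hx, hsum]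
    norm_num
  obtain ⟨z, hzS, hz⟩ := Finset.exists_min_image S f hSne
  refine ⟨f z, (Finset.mem_filter.1 hzS).2, ?_⟩
  have hsplit := Finset.sum_filter_add_sum_filter_not Finset.univ (fun x => f z ≤ f x) π
  rw [hsum] at hsplit
  by_contra hlt
  push Not at hlt
  have hbig : 1 / 2 < ∑ x ∈ Finset.univ.filter (fun x => ¬ f z ≤ f x), π x := by linarith
  have hne' : (Finset.univ.filter fun x => ¬ f z ≤ f x).Nonempty := by
    by_contra h
    rw [Finset.not_nonempty_iff_eq_empty] at h
    rw [h, Finset.sum_empty] at hbig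
    linarith
  obtain ⟨w, hw, hwmax⟩ := Finset.exists_max_image _ f hne'
  have hwz := (Finset.mem_filter.1 hw).2
  refine hwz (hz w (Finset.mem_filter.2 ⟨Finset.mem_univ w, hbig.le.trans ?_⟩))
  exact Finset.sum_le_sum_of_subset_of_nonneg
    (fun x hx => Finset.mem_filter.2 ⟨Finset.mem_univ x, hwmax x hx⟩) fun x _ _ => hπ x

/-- A Poincaré inequality from hitting times of sets of mass at least one half. -/
lemma IsLazyReversible.poincare (h : IsLazyReversible K π) {T : ℝ} (hTpos : 0 < T)
    (hT : ∀ A : Finset Θ, 1 / 2 ≤ ∑ x ∈ A, π x →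
      ∀ x N, ∑ s ∈ Finset.range N, surv K A s x ≤ T)
    (f : Θ → ℝ) (hf : ∑ x, π x * f x = 0) :
    wip π f f ≤ T * (wip π f f - wip π f (K.1 *ᵥ f)) := by
  obtain ⟨m, hm1, hm2⟩ := exists_median h.nonneg h.sum_eq_one f
  -- The positive and negative parts of `f - m` each vanish on a set of mass at least one half, so
  -- the Dirichlet eigenvalue bound applies to both.
  set p : Θ → ℝ := fun x => max (f x - m) 0 with hp
  set q : Θ → ℝ := fun x => max (m - f x) 0 with hq
  have hp1 := h.wip_le_of_eq_zero _ hTpos (hT _ hm1) p fun x hx =>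
    max_eq_right (by linarith [(Finset.mem_filter.1 hx).2])
  have hq1 := h.wip_le_of_eq_zero _ hTpos (hT _ hm2) q fun x hx =>
    max_eq_right (by linarith [(Finset.mem_filter.1 hx).2])
  have hp0 : ∀ x, 0 ≤ p x := fun x => le_max_right _ _
  have hq0 : ∀ x, 0 ≤ q x := fun x => le_max_right _ _
  have hpq : ∀ x, f x - m = p x - q x := fun x => by
    rcases le_total (f x) m with hx | hx
    · rw [hp, hq]; simp only
      rw [max_eq_right (by linarith), max_eq_left (by linarith)]; ring
    · rw [hp, hq]; simp only
      rw [max_eq_left (by linarith), max_eq_right (by linarith)]; ring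
  have hpq0 : ∀ x, p x * q x = 0 := fun x => by
    rcases le_total (f x) m with hx | hx
    · rw [hp]; simp only
      rw [max_eq_right (by linarith), zero_mul]
    · rw [hq]; simp only
      rw [max_eq_right (by linarith : m - f x ≤ 0), mul_zero]
  -- The right side is the second moment of `f` about `m`, which is least about the mean, here zero.
  have hvar : wip π f f ≤ wip π p p + wip π q q := by
    have e : wip π p p + wip π q q = ∑ x, π x * (f x * f x) - 2 * m * ∑ x, π x * f x +
        m ^ 2 * ∑ x, π x := by
      simp only [wip, Finset.mul_sum, ← Finset.sum_add_distrib, ← Finset.sum_sub_distrib]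
      refine Finset.sum_congr rfl fun x _ => ?_
      have e1 : p x * p x + q x * q x = (f x - m) ^ 2 := by
        rw [hpq x]; linear_combination 2 * hpq0 x
      linear_combination π x * e1
    rw [e, hf, h.sum_eq_one, wip]
    nlinarith [sq_nonneg m]
  -- The cross terms have the favourable sign because `p` and `q` are nonnegative with disjoint
  -- supports.
  have hform : ∑ x, ∑ y, π x * K.1 x y * ((p x - p y) * (p x - p y)) +
      ∑ x, ∑ y, π x * K.1 x y * ((q x - q y) * (q x - q y)) ≤
      ∑ x, ∑ y, π x * K.1 x y * ((f x - f y) * (f x - f y)) := by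
    simp only [← Finset.sum_add_distrib, ← mul_add]
    refine Finset.sum_le_sum fun x _ => Finset.sum_le_sum fun y _ =>
      mul_le_mul_of_nonneg_left ?_ (mul_nonneg (h.nonneg x) (kernel_nonneg K x y))
    have e : f x - f y = (p x - q x) - (p y - q y) := by rw [← hpq, ← hpq]; ring
    rw [e]
    nlinarith [mul_nonneg (hp0 x) (hq0 y), mul_nonneg (hp0 y) (hq0 x), hpq0 x, hpq0 y]
  rw [h.sum_sum_sub_mul_sub, h.sum_sum_sub_mul_sub, h.sum_sum_sub_mul_sub] at hform
  have := mul_le_mul_of_nonneg_left hform hTpos.le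
  linarith

end Poincare

/-! ### Mixing times bounded by hitting times -/

section UpperBound

variable {Θ : Type u} [Fintype Θ] [DecidableEq Θ] {K : rowStochastic ℝ Θ} {π : Θ → ℝ}

/-- A substitute for a maximal inequality: telescoping and Cauchy–Schwarz give a bound that does not
depend on `r`, so one exceptional set serves all `r ≤ H`. -/
lemma sq_pow_mulVec_le (K : rowStochastic ℝ Θ) (f : Θ → ℝ) {s r H : ℕ} (hr : r ≤ H) (y : Θ) :
    (K.1 ^ (s + r) *ᵥ f) y ^ 2 ≤ 2 * (K.1 ^ s *ᵥ f) y ^ 2 +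
      2 * (H * ∑ j ∈ Finset.range H, (K.1 ^ (s + j) *ᵥ (f - K.1 *ᵥ f)) y ^ 2) := by
  have e : ∀ j, (K.1 ^ (s + j) *ᵥ (f - K.1 *ᵥ f)) y =
      (K.1 ^ (s + j) *ᵥ f) y - (K.1 ^ (s + (j + 1)) *ᵥ f) y := fun j => by
    rw [mulVec_sub, mulVec_mulVec, ← pow_succ]; rfl
  have h1 : ∑ j ∈ Finset.range r, (K.1 ^ (s + j) *ᵥ (f - K.1 *ᵥ f)) y =
      (K.1 ^ s *ᵥ f) y - (K.1 ^ (s + r) *ᵥ f) y := by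
    rw [Finset.sum_congr rfl fun j _ => e j,
      Finset.sum_range_sub' (fun j => (K.1 ^ (s + j) *ᵥ f) y)]
    rfl
  have h2 : (∑ j ∈ Finset.range r, (K.1 ^ (s + j) *ᵥ (f - K.1 *ᵥ f)) y) ^ 2 ≤
      H * ∑ j ∈ Finset.range H, (K.1 ^ (s + j) *ᵥ (f - K.1 *ᵥ f)) y ^ 2 := by
    refine sq_sum_le_card_mul_sum_sq.trans ?_
    rw [Finset.card_range]
    refine mul_le_mul (by exact_mod_cast hr) (Finset.sum_le_sum_of_subset_of_nonneg
      (Finset.range_mono hr) fun j _ _ => sq_nonneg _)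
      (Finset.sum_nonneg fun j _ => sq_nonneg _) (Nat.cast_nonneg _)
  rw [h1] at h2
  nlinarith [sq_nonneg ((K.1 ^ s *ᵥ f) y + ((K.1 ^ s *ᵥ f) y - (K.1 ^ (s + r) *ᵥ f) y))]

lemma abs_mulVec_le (K : rowStochastic ℝ Θ) {f b : Θ → ℝ} (h : ∀ y, |f y| ≤ b y) (x : Θ) :
    |(K.1 *ᵥ f) x| ≤ ∑ y, K.1 x y * b y := by
  refine (Finset.abs_sum_le_sum_abs _ _).trans (Finset.sum_le_sum fun y _ => ?_)
  rw [abs_mul, abs_of_nonneg (kernel_nonneg K x y)]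
  exact mul_le_mul_of_nonneg_left (h y) (kernel_nonneg K x y)

/-- Stop the chain on first meeting `G`: the remaining iterate is then at most `δ`. If `G` is not
met within `r` steps, the trivial bound by one is paid with probability `surv K G r x`. -/
lemma abs_pow_mulVec_le_add_surv (K : rowStochastic ℝ Θ) {f : Θ → ℝ} (hf : ∀ x, |f x| ≤ 1)
    (G : Finset Θ) {s H : ℕ} {δ : ℝ} (hδ : 0 ≤ δ)
    (hG : ∀ y ∈ G, ∀ r ≤ H, |(K.1 ^ (s + r) *ᵥ f) y| ≤ δ) {r : ℕ} (hr : r ≤ H) (x : Θ) :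
    |(K.1 ^ (s + r) *ᵥ f) x| ≤ δ + surv K G r x := by
  induction r generalizing x with
  | zero =>
    by_cases hx : x ∈ G
    · simpa [surv_of_mem K G hx] using hG x hx 0 (Nat.zero_le _)
    · have h1 := abs_mulVec_le (K ^ s) hf x
      rw [Finset.sum_congr rfl fun y _ => mul_one _, kernel_sum] at h1
      have h2 : surv K G 0 x = 1 := by simp [surv, hx]
      rw [h2]
      change |(K.1 ^ s *ᵥ f) x| ≤ _
      change |(K.1 ^ s *ᵥ f) x| ≤ _ at h1
      linarith
  | succ r ih =>
    by_cases hx : x ∈ G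
    · rw [surv_of_mem K G hx, add_zero]
      exact hG x hx _ hr
    · rw [surv_succ_of_notMem K G hx, ← add_assoc, pow_mulVec_succ]
      refine (abs_mulVec_le K (fun y => ih (by omega) y) x).trans ?_
      simp only [mul_add, Finset.sum_add_distrib]
      rw [← Finset.sum_mul, kernel_sum, one_mul]

/-- The chain is mixed after a multiple of the largest expected hitting time of sets of mass at
least one half. -/
lemma IsLazyReversible.abs_pow_mulVec_le (h : IsLazyReversible K π) {n : ℕ} (hn : 0 < n)
    (hT : ∀ A : Finset Θ, 1 / 2 ≤ ∑ x ∈ A, π x →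
      ∀ x N, ∑ s ∈ Finset.range N, surv K A s x ≤ n)
    {f : Θ → ℝ} (hf : ∑ x, π x * f x = 0) (hf1 : ∀ x, |f x| ≤ 1) (hf2 : wip π f f ≤ 1 / 4)
    (x : Θ) : |(K.1 ^ (560 * n) *ᵥ f) x| ≤ 3 / 16 := by
  have hn' : (0 : ℝ) < n := by exact_mod_cast hn
  set s := 544 * n with hs
  set H := 16 * n with hH
  set d : ℕ → Θ → ℝ := fun j => K.1 ^ (s + j) *ᵥ (f - K.1 *ᵥ f) with hd
  set F : Θ → ℝ := fun y => 2 * (K.1 ^ s *ᵥ f) y ^ 2 +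
    2 * (H * ∑ j ∈ Finset.range H, d j y ^ 2) with hF
  have hF0 : ∀ y, 0 ≤ F y := fun y => by positivity
  have hmean : ∑ y, π y * F y ≤ 1 / 128 := by
    have e : ∑ y, π y * F y = 2 * wip π (K.1 ^ s *ᵥ f) (K.1 ^ s *ᵥ f) +
        2 * (H * ∑ j ∈ Finset.range H, wip π (d j) (d j)) := by
      simp only [hF, wip]
      rw [Finset.sum_comm]
      simp only [Finset.mul_sum, ← Finset.sum_add_distrib]
      refine Finset.sum_congr rfl fun y _ => ?_
      rw [mul_add, Finset.mul_sum]
      congr 1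
      · ring
      · exact Finset.sum_congr rfl fun j _ => by ring
    -- Poincaré applied to `K ^ s f` bounds its squared norm by `n` times one autocorrelation drop,
    -- already known to be of order `1 / s`.
    have h1 := h.poincare hn' hT (K.1 ^ s *ᵥ f) (by rw [h.sum_pow_mulVec, hf])
    rw [← pow_mulVec_succ, h.wip_pow_pow, h.wip_pow_pow, ← add_assoc, ← two_mul] at h1
    have h2 := h.mul_autocorr_drop_le f (2 * s)
    have h3 := h.sum_wip_increment_le f s H
    rw [e, h.wip_pow_pow, ← two_mul]
    have hsR : (s : ℝ) = 544 * n := by rw [hs]; push_cast; ring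
    have hHR : (H : ℝ) = 16 * n := by rw [hH]; push_cast; ring
    push_cast at h2
    change (2 * (s : ℝ) + 1) * ∑ j ∈ Finset.range H, wip π (d j) (d j) ≤ wip π f f at h3
    set D := autocorr K π f (2 * s) - autocorr K π f (2 * s + 1)
    set R := ∑ j ∈ Finset.range H, wip π (d j) (d j)
    have hD : 0 ≤ D := h.autocorr_drop_nonneg f s
    have hR : 0 ≤ R := Finset.sum_nonneg fun j _ => h.wip_self_nonneg _
    rw [hsR] at h2 h3
    rw [hHR]
    -- As `2 s = 1088 n` and the variance is at most `1/4`, both `n D` and `n R` are at most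
    -- `1/4352`; the mean of `F` is then at most `(2 + 2 * 16) / 4352 = 1/128`.
    have h4 : n * D ≤ 1 / 4352 := by nlinarith
    have h5 : n * R ≤ 1 / 4352 := by nlinarith
    nlinarith
  -- The threshold is twice the mean bound, so Markov's inequality leaves `G` mass at least one
  -- half, and it is the square of `1/8`.
  set G := Finset.univ.filter fun y => F y ≤ 1 / 64 with hGdef
  have hG : 1 / 2 ≤ ∑ y ∈ G, π y := by
    have hsplit := Finset.sum_filter_add_sum_filter_not Finset.univ (fun y => F y ≤ 1 / 64) π
    rw [h.sum_eq_one] at hsplit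
    have h1 : ∑ y ∈ Finset.univ.filter (fun y => ¬ F y ≤ 1 / 64), π y * (1 / 64) ≤
        ∑ y, π y * F y :=
      (Finset.sum_le_sum fun y hy => mul_le_mul_of_nonneg_left
        (not_le.1 (Finset.mem_filter.1 hy).2).le (h.nonneg y)).trans
        (Finset.sum_le_sum_of_subset_of_nonneg (Finset.filter_subset _ _)
          fun y _ _ => mul_nonneg (h.nonneg y) (hF0 y))
    rw [← Finset.sum_mul] at h1
    linarith
  have hGr : ∀ y ∈ G, ∀ r ≤ H, |(K.1 ^ (s + r) *ᵥ f) y| ≤ 1 / 8 := fun y hy r hr => by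
    refine abs_le_of_sq_le_sq ?_ (by norm_num)
    have h1 := (sq_pow_mulVec_le K f hr y).trans (Finset.mem_filter.1 hy).2
    linarith
  have h1 := abs_pow_mulVec_le_add_surv K hf1 G (by norm_num) hGr le_rfl x
  have h2 : surv K G H x ≤ 1 / 16 := by
    have h3 := hT G hG x (H + 1)
    have h4 : ∑ t ∈ Finset.range (H + 1), surv K G H x ≤
        ∑ t ∈ Finset.range (H + 1), surv K G t x :=
      Finset.sum_le_sum fun t ht => surv_antitone K G x (by
        have := Finset.mem_range.1 ht; omega)
    rw [Finset.sum_const, Finset.card_range, nsmul_eq_mul] at h4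
    have hHR : (H : ℝ) = 16 * n := by rw [hH]; push_cast; ring
    push_cast at h4
    rw [hHR] at h4
    have := surv_nonneg K G H x
    nlinarith
  have h3 : 560 * n = s + H := by omega
  rw [h3]
  linarith

lemma IsLazyReversible.mixingTime_le_of_hitting (h : IsLazyReversible K π) {n : ℕ} (hn : 0 < n)
    (hT : ∀ A : Finset Θ, 1 / 2 ≤ ∑ x ∈ A, π x →
      ∀ x N, ∑ s ∈ Finset.range N, surv K A s x ≤ n) :
    mixingTime K.1 π ≤ (560 * n : ℕ) := by
  refine mixingTime_le (by omega) fun x => lt_of_le_of_lt (ciSup_le fun B => ?_)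
    (by norm_num : (3 : ℝ) / 16 < 1 / 4)
  set b := ∑ y ∈ B, π y with hb
  have hb0 : 0 ≤ b := Finset.sum_nonneg fun y _ => h.nonneg y
  have hb1 : b ≤ 1 := by
    rw [← h.sum_eq_one]
    exact Finset.sum_le_sum_of_subset_of_nonneg (Finset.subset_univ _) fun y _ _ => h.nonneg y
  set f : Θ → ℝ := fun y => (if y ∈ B then 1 else 0) - b with hf
  have hsum : ∀ μ : Θ → ℝ, ∑ y, μ y = 1 → ∑ y, μ y * f y = ∑ y ∈ B, μ y - b := by
    intro μ hμ
    simp [hf, mul_sub, Finset.sum_sub_distrib, ← Finset.sum_mul, hμ]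
  have h1 := h.abs_pow_mulVec_le hn hT (f := f) (by rw [hsum π h.sum_eq_one]; ring)
    (fun y => by
      simp only [hf]
      split_ifs <;> rw [abs_le] <;> constructor <;> linarith)
    (by
      have e : wip π f f = (1 - 2 * b) * ∑ y, π y * f y + b * (1 - b) * ∑ y, π y := by
        rw [wip, Finset.mul_sum Finset.univ _ (1 - 2 * b),
          Finset.mul_sum Finset.univ _ (b * (1 - b)), ← Finset.sum_add_distrib]
        refine Finset.sum_congr rfl fun y _ => ?_
        simp only [hf]
        split_ifs <;> ring
      rw [e, hsum π h.sum_eq_one, h.sum_eq_one]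
      nlinarith [sq_nonneg (b - 1 / 2)]) x
  have h2 : (K.1 ^ (560 * n) *ᵥ f) x = ∑ y ∈ B, (K.1 ^ (560 * n)) x y - b :=
    hsum _ (pow_row_sum K _ x)
  rw [h2] at h1
  exact (le_abs_self _).trans h1

variable [MeasurableSpace Θ] [DiscreteMeasurableSpace Θ]

/-- Some state has mass at most one half; its complement is an admissible target and takes at least
one step to reach. This lets the rounding of `t_H` to an integer be absorbed in a constant. -/
lemma IsLazyReversible.one_le_maxHittingTime [Nontrivial Θ] (h : IsLazyReversible K π) {α : ℝ}
    (hα : α ≤ 1 / 2) : 1 ≤ maxHittingTime K π α := by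
  obtain ⟨x, hx⟩ : ∃ x, π x ≤ 1 / 2 := by
    obtain ⟨x, y, hxy⟩ := exists_pair_ne Θ
    by_contra hne
    push Not at hne
    have h1 : ∑ z ∈ {x, y}, π z ≤ ∑ z, π z :=
      Finset.sum_le_sum_of_subset_of_nonneg (Finset.subset_univ _) fun y _ _ => h.nonneg y
    rw [Finset.sum_pair hxy, h.sum_eq_one] at h1
    linarith [hne x, hne y]
  have hA : α ≤ ∑ y ∈ Finset.univ.erase x, π y := by
    have := Finset.add_sum_erase Finset.univ π (Finset.mem_univ x)
    rw [h.sum_eq_one] at this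
    linarith
  refine le_trans ?_ (le_iSup_of_le x (le_iSup₂_of_le (Finset.univ.erase x) hA le_rfl))
  rw [lintegral_hittingTime]
  refine le_trans ?_ (ENNReal.le_tsum 0)
  simp [surv]

lemma sum_surv_le_maxHittingTime {α : ℝ} (htop : maxHittingTime K π α ≠ ⊤) {A : Finset Θ}
    (hA : α ≤ ∑ y ∈ A, π y) (x : Θ) (N : ℕ) :
    ∑ s ∈ Finset.range N, surv K A s x ≤ (maxHittingTime K π α).toReal := by
  rw [← ENNReal.ofReal_le_iff_le_toReal htop,
    ENNReal.ofReal_sum_of_nonneg fun s _ => surv_nonneg K A s x]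
  refine (ENNReal.sum_le_tsum _).trans ?_
  rw [← lintegral_hittingTime]
  exact le_iSup_of_le x (le_iSup₂_of_le A hA le_rfl)

end UpperBound

lemma exists_isUpperConstant {α : ℝ} (hα : α ≤ 1 / 2) : ∃ c, IsUpperConstant.{u} α c := by
  -- `1120 = 2 * 560`, the factor two covering `⌈T⌉₊ ≤ T + 1 ≤ 2 T`.
  refine ⟨1120, by norm_num, fun S _ _ _ _ _ K π h => ?_⟩
  by_cases htop : maxHittingTime K π α = ⊤
  · rw [htop, ENNReal.mul_top (by simp)]
    exact le_top
  have h1 := h.one_le_maxHittingTime hα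
  set T := (maxHittingTime K π α).toReal with hT
  have hT1 : 1 ≤ T := by
    rw [hT, ← ENNReal.toReal_one]
    exact ENNReal.toReal_mono htop h1
  have hn : 0 < ⌈T⌉₊ := Nat.ceil_pos.2 (by linarith)
  refine (h.mixingTime_le_of_hitting hn fun A hA x N =>
    (sum_surv_le_maxHittingTime htop (hα.trans hA) x N).trans (Nat.le_ceil T)).trans ?_
  rw [← ENNReal.ofReal_toReal htop, ← hT, ← ENNReal.ofReal_mul (by norm_num),
    ← ENNReal.ofReal_natCast]
  refine ENNReal.ofReal_le_ofReal ?_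
  push_cast
  have := Nat.ceil_lt_add_one (by linarith : 0 ≤ T)
  linarith

/-! ### The trace chain: reversible, lazy and irreducible -/

section FirstVisit

variable {Θ : Type u} [Fintype Θ] [DecidableEq Θ]

omit [Fintype Θ] in
lemma visitTime_one_eq_iff (S : Finset Θ) (Z : ℕ → Θ) (t : ℕ) :
    visitTime S Z 1 = t ↔ 0 < t ∧ Z t ∈ S ∧ ∀ s, 0 < s → s < t → Z s ∉ S := by
  classical
  have e : visitTime S Z 1 = ⨅ (t : ℕ) (_ : 0 < t ∧ Z t ∈ S), (t : ℕ∞) := by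
    simp [visitTime]
  rw [e]
  by_cases h : ∃ t, 0 < t ∧ Z t ∈ S
  · have h1 : (⨅ (t : ℕ) (_ : 0 < t ∧ Z t ∈ S), (t : ℕ∞)) = Nat.find h := by
      refine le_antisymm (iInf₂_le (Nat.find h) (Nat.find_spec h)) (le_iInf₂ fun t ht => ?_)
      exact_mod_cast Nat.find_min' h ht
    rw [h1, Nat.cast_inj, Nat.find_eq_iff]
    constructor
    · rintro ⟨⟨h1, h2⟩, h3⟩
      exact ⟨h1, h2, fun s hs hst hS => h3 s hst ⟨hs, hS⟩⟩
    · rintro ⟨h1, h2, h3⟩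
      exact ⟨⟨h1, h2⟩, fun s hst hs => h3 s hs.1 hst hs.2⟩
  · have h1 : (⨅ (t : ℕ) (_ : 0 < t ∧ Z t ∈ S), (t : ℕ∞)) = ⊤ :=
      iInf₂_eq_top.2 fun t ht => absurd ⟨t, ht⟩ h
    rw [h1]
    constructor
    · intro h2
      exact absurd h2.symm (ENat.natCast_ne_top t)
    · rintro ⟨h2, h3, -⟩
      exact absurd ⟨t, h2, h3⟩ h

/-- The trajectories whose first visit to `S`, at a time at least `k`, is at `y`. -/
def firstVisit (S : Finset Θ) (k : ℕ) (y : Θ) : Set (ℕ → Θ) :=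
  {Z | ∃ t, k ≤ t ∧ Z t = y ∧ ∀ s, k ≤ s → s < t → Z s ∉ S}

omit [Fintype Θ] [DecidableEq Θ] in
lemma consPath_preimage_firstVisit (S : Finset Θ) (x y : Θ) :
    consPath x ⁻¹' firstVisit S 1 y = firstVisit S 0 y := by
  ext Z
  simp only [firstVisit, Set.mem_preimage, Set.mem_ofPred_eq]
  constructor
  · rintro ⟨t, ht, h1, h2⟩
    obtain ⟨t, rfl⟩ := Nat.exists_eq_succ_of_ne_zero (by omega : t ≠ 0)
    exact ⟨t, Nat.zero_le _, h1, fun s _ hs => h2 (s + 1) (by omega) (by omega)⟩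
  · rintro ⟨t, -, h1, h2⟩
    refine ⟨t + 1, by omega, h1, fun s hs hst => ?_⟩
    obtain ⟨s, rfl⟩ := Nat.exists_eq_succ_of_ne_zero (by omega : s ≠ 0)
    exact h2 s (Nat.zero_le _) (by omega)

omit [Fintype Θ] [DecidableEq Θ] in
lemma mem_firstVisit_zero_of_mem {S : Finset Θ} {Z : ℕ → Θ} (h : Z 0 ∈ S) (y : Θ) :
    Z ∈ firstVisit S 0 y ↔ Z 0 = y := by
  constructor
  · rintro ⟨t, -, h1, h2⟩
    rcases Nat.eq_zero_or_pos t with rfl | ht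
    · exact h1
    · exact absurd h (h2 0 le_rfl ht)
  · intro h1
    exact ⟨0, le_rfl, h1, fun s _ hs => absurd hs (Nat.not_lt_zero s)⟩

omit [Fintype Θ] [DecidableEq Θ] in
lemma mem_firstVisit_zero_of_notMem {S : Finset Θ} {Z : ℕ → Θ} (h : Z 0 ∉ S) {y : Θ}
    (hy : y ∈ S) : Z ∈ firstVisit S 0 y ↔ Z ∈ firstVisit S 1 y := by
  constructor
  · rintro ⟨t, -, h1, h2⟩
    rcases Nat.eq_zero_or_pos t with rfl | ht
    · exact absurd (h1 ▸ hy) h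
    · exact ⟨t, ht, h1, fun s _ hst => h2 s (Nat.zero_le _) hst⟩
  · rintro ⟨t, ht, h1, h2⟩
    refine ⟨t, Nat.zero_le _, h1, fun s _ hst => ?_⟩
    rcases Nat.eq_zero_or_pos s with rfl | hs
    · exact h
    · exact h2 s hs hst

omit [Fintype Θ] [DecidableEq Θ] in
lemma disjoint_firstVisit (S : Finset Θ) (k : ℕ) {y z : Θ} (hy : y ∈ S) (hz : z ∈ S)
    (hyz : y ≠ z) : Disjoint (firstVisit S k y) (firstVisit S k z) := by
  rw [Set.disjoint_left]
  rintro Z ⟨t, ht, h1, h2⟩ ⟨t', ht', h1', h2'⟩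
  rcases lt_trichotomy t t' with h | rfl | h
  · exact h2' t ht h (h1 ▸ hy)
  · exact hyz (h1.symm.trans h1')
  · exact h2 t' ht' h (h1' ▸ hz)

variable [MeasurableSpace Θ] [DiscreteMeasurableSpace Θ]

omit [Fintype Θ] [DecidableEq Θ] in
lemma measurableSet_firstVisit (S : Finset Θ) (k : ℕ) (y : Θ) :
    MeasurableSet (firstVisit S k y) := by
  have : firstVisit S k y = ⋃ t ∈ Set.Ici k, ({Z | Z t ∈ ({y} : Set Θ)} ∩
      ⋂ s ∈ Set.Ico k t, {Z | Z s ∈ ((S : Set Θ)ᶜ)}) := by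
    ext Z
    simp [firstVisit, and_left_comm]
  rw [this]
  exact MeasurableSet.biUnion (Set.to_countable _) fun t _ =>
    (measurableSet_coord_mem t _).inter
      (MeasurableSet.biInter (Set.to_countable _) fun s _ => measurableSet_coord_mem s _)

/-- The probability that the first visit to `S` at a positive time is at `y`. -/
def hit (K : rowStochastic ℝ Θ) (S : Finset Θ) (z y : Θ) : ℝ :=
  (pathLaw K z).real (firstVisit S 1 y)

lemma traceMatrix_eq_hit (K : rowStochastic ℝ Θ) (S : Finset Θ) (x y : S) :
    traceMatrix K S x y = hit K S x y := by
  unfold traceMatrix hit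
  congr 1
  ext Z
  simp only [visitTime_one_eq_iff, firstVisit, Set.mem_ofPred_eq]
  constructor
  · rintro ⟨t, ⟨h1, -, h3⟩, h4⟩
    exact ⟨t, h1, h4, h3⟩
  · rintro ⟨t, h1, h4, h3⟩
    exact ⟨t, ⟨h1, h4 ▸ y.2, h3⟩, h4⟩

variable (K : rowStochastic ℝ Θ) (S : Finset Θ)

lemma hit_nonneg (z y : Θ) : 0 ≤ hit K S z y := measureReal_nonneg

lemma pathLaw_real_apply (x : Θ) {E : Set (ℕ → Θ)} (hE : MeasurableSet E) :
    (pathLaw K x).real E = ∑ y, K.1 x y * (pathLaw K y).real (consPath x ⁻¹' E) := by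
  rw [measureReal_def, pathLaw_apply K x hE,
    ENNReal.toReal_sum fun y _ => ENNReal.mul_ne_top ENNReal.ofReal_ne_top (measure_ne_top _ _)]
  refine Finset.sum_congr rfl fun y _ => ?_
  rw [ENNReal.toReal_mul, ENNReal.toReal_ofReal (kernel_nonneg K x y), measureReal_def]

lemma pathLaw_real_congr (x : Θ) {E F : Set (ℕ → Θ)} (h : ∀ Z, Z 0 = x → (Z ∈ E ↔ Z ∈ F)) :
    (pathLaw K x).real E = (pathLaw K x).real F := by
  refine measureReal_congr ?_
  filter_upwards [pathLaw_start_eq K x] with Z hZ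
  exact propext (h Z hZ)

/-- First-step analysis: a first step into `S` settles the visit at once, and after a step to `w ∉
S` the problem restarts from `w`. -/
lemma hit_eq (z : Θ) {y : Θ} (hy : y ∈ S) :
    hit K S z y = K.1 z y + ∑ w ∈ Sᶜ, K.1 z w * hit K S w y := by
  rw [hit, pathLaw_real_apply K z (measurableSet_firstVisit S 1 y),
    consPath_preimage_firstVisit, ← Finset.sum_add_sum_compl S]
  congr 1
  · rw [Finset.sum_eq_single_of_mem y hy]
    · rw [pathLaw_real_congr K y (F := Set.univ)]
      · simp
      · intro Z hZ
        simp [mem_firstVisit_zero_of_mem (hZ ▸ hy : Z 0 ∈ S), hZ]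
    · intro w hw hwy
      rw [pathLaw_real_congr K w (F := ∅)]
      · simp
      · intro Z hZ
        simp [mem_firstVisit_zero_of_mem (hZ ▸ hw : Z 0 ∈ S), hZ, hwy]
  · refine Finset.sum_congr rfl fun w hw => ?_
    rw [hit, pathLaw_real_congr K w]
    intro Z hZ
    exact mem_firstVisit_zero_of_notMem (by rw [hZ]; exact Finset.mem_compl.1 hw) hy

lemma sum_hit_le_one (z : Θ) : ∑ y ∈ S, hit K S z y ≤ 1 := by
  unfold hit
  rw [← measureReal_biUnion_finset
    (fun y hy y' hy' hne => disjoint_firstVisit S 1 hy hy' hne)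
    fun y _ => measurableSet_firstVisit S 1 y]
  exact measureReal_le_one

variable {K} {π : Θ → ℝ}

lemma IsLazyReversible.sum_hit (h : IsLazyReversible K π) {x : Θ} (hx : x ∈ S) :
    ∑ y ∈ S, hit K S x y = 1 := by
  set v : Θ → ℝ := fun z => 1 - ∑ y ∈ S, hit K S z y with hv
  have hv0 : ∀ z, 0 ≤ v z := fun z => sub_nonneg.2 (sum_hit_le_one K S z)
  have hrec : ∀ z, v z = ∑ w ∈ Sᶜ, K.1 z w * v w := by
    intro z
    have h1 : ∑ y ∈ S, hit K S z y =
        ∑ y ∈ S, K.1 z y + ∑ w ∈ Sᶜ, K.1 z w * ∑ y ∈ S, hit K S w y := by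
      rw [Finset.sum_congr rfl fun y hy => hit_eq K S z hy, Finset.sum_add_distrib,
        Finset.sum_comm]
      simp only [Finset.mul_sum]
    have h2 : ∑ y ∈ S, K.1 z y + ∑ w ∈ Sᶜ, K.1 z w = 1 := by
      rw [Finset.sum_add_sum_compl, kernel_sum]
    simp only [hv, mul_sub, mul_one, Finset.sum_sub_distrib]
    linarith
  -- The escape probability `v` is the image under `K` of its restriction off `S`. Stationarity
  -- equates their means, so `v` has zero mass on `S`.
  have h1 := h.sum_mulVec (fun z => if z ∈ S then 0 else v z)
  have h2 : K.1 *ᵥ (fun z => if z ∈ S then 0 else v z) = v := by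
    ext z
    change ∑ w, K.1 z w * (if w ∈ S then 0 else v w) = _
    rw [hrec z, ← Finset.sum_add_sum_compl S,
      Finset.sum_eq_zero fun w hw => by rw [if_pos hw, mul_zero], zero_add]
    exact Finset.sum_congr rfl fun w hw => by rw [if_neg (Finset.mem_compl.1 hw)]
  rw [h2, ← sub_eq_zero, ← Finset.sum_sub_distrib] at h1
  have h3 := (Finset.sum_eq_zero_iff_of_nonneg (fun z _ => by
    split_ifs
    · simpa using mul_nonneg (h.nonneg z) (hv0 z)
    · simp)).1 h1 x (Finset.mem_univ x)
  rw [if_pos hx, mul_zero, sub_zero] at h3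
  have h4 := (mul_eq_zero.1 h3).resolve_left (h.pos x).ne'
  simp only [hv] at h4
  linarith

/-- Detailed balance for the trace. -/
lemma IsLazyReversible.hit_balance (h : IsLazyReversible K π) {x y : Θ} (hx : x ∈ S)
    (hy : y ∈ S) : π x * hit K S x y = π y * hit K S y x := by
  -- Detailed balance turns a step from `x` out to `w` into a step from `w` to `x`, which first-step
  -- analysis rewrites by hitting probabilities. What remains is a Dirichlet form off `S`, symmetric
  -- in `x` and `y`.
  have key : ∀ {x y : Θ}, x ∈ S → y ∈ S → π x * hit K S x y = π x * K.1 x y +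
      (∑ w ∈ Sᶜ, π w * (hit K S w x * hit K S w y) -
        ∑ w ∈ Sᶜ, ∑ z ∈ Sᶜ, π w * K.1 w z * (hit K S z x * hit K S w y)) := by
    intro x y hx hy
    rw [hit_eq K S x hy, mul_add, Finset.mul_sum, ← Finset.sum_sub_distrib]
    congr 1
    refine Finset.sum_congr rfl fun w _ => ?_
    have e : ∑ z ∈ Sᶜ, π w * K.1 w z * (hit K S z x * hit K S w y) =
        π w * hit K S w y * ∑ z ∈ Sᶜ, K.1 w z * hit K S z x := by
      rw [Finset.mul_sum]
      exact Finset.sum_congr rfl fun z _ => by ring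
    rw [e]
    linear_combination hit K S w y * h.detailed_balance x w -
      π w * hit K S w y * hit_eq K S w hx
  rw [key hx hy, key hy hx, h.detailed_balance x y]
  congr 2
  · exact Finset.sum_congr rfl fun w _ => by ring
  · rw [Finset.sum_comm]
    refine Finset.sum_congr rfl fun w _ => Finset.sum_congr rfl fun z _ => ?_
    rw [h.detailed_balance]
    ring

lemma le_hit (z : Θ) {y : Θ} (hy : y ∈ S) : K.1 z y ≤ hit K S z y := by
  rw [hit_eq K S z hy]
  have : 0 ≤ ∑ w ∈ Sᶜ, K.1 z w * hit K S w y :=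
    Finset.sum_nonneg fun w _ => mul_nonneg (kernel_nonneg K z w) (hit_nonneg K S w y)
  linarith

lemma mul_hit_le_hit (z : Θ) {w y : Θ} (hw : w ∉ S) (hy : y ∈ S) :
    K.1 z w * hit K S w y ≤ hit K S z y := by
  rw [hit_eq K S z hy]
  have h1 : K.1 z w * hit K S w y ≤ ∑ w ∈ Sᶜ, K.1 z w * hit K S w y :=
    Finset.single_le_sum (f := fun w => K.1 z w * hit K S w y)
    (fun w _ => mul_nonneg (kernel_nonneg K z w) (hit_nonneg K S w y)) (Finset.mem_compl.2 hw)
  have h2 := kernel_nonneg K z y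
  linarith

/-- The transition matrix of the trace is stochastic. -/
def traceKernel (h : IsLazyReversible K π) : rowStochastic ℝ S :=
  ⟨traceMatrix K S, mem_rowStochastic_iff_sum.2
    ⟨fun x y => by rw [traceMatrix_eq_hit]; exact hit_nonneg K S x y, fun x => by
      simp only [traceMatrix_eq_hit]
      rw [Finset.sum_coe_sort S fun y => hit K S x y]
      exact h.sum_hit S x.2⟩⟩

lemma traceKernel_apply (h : IsLazyReversible K π) (x y : S) :
    (traceKernel S h).1 x y = hit K S x y := traceMatrix_eq_hit K S x y

/-- Follow a path of positive probability from `z` to `y` and record its visits to `S`: these form a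
path of positive probability for the trace. The first recorded state is `y'`. -/
lemma exists_pos_hit_of_pow_pos (h : IsLazyReversible K π) {k : ℕ} (z : Θ) (y : S)
    (hk : 0 < (K.1 ^ (k + 1)) z y) :
    ∃ y' : S, 0 < hit K S z y' ∧ ∃ m, 0 < ((traceKernel S h).1 ^ m) y' y := by
  induction k generalizing z with
  | zero =>
    rw [zero_add, pow_one] at hk
    exact ⟨y, hk.trans_le (le_hit S z y.2), 0, by simp⟩
  | succ k ih =>
    rw [pow_succ', mul_apply] at hk
    obtain ⟨w, -, hw⟩ := Finset.exists_lt_of_sum_lt (s := Finset.univ) (f := fun _ : Θ => (0 : ℝ))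
      (by simpa using hk)
    have hzw : 0 < K.1 z w := pos_of_mul_pos_left hw (pow_nonneg_entry K _ w y)
    have hwy : 0 < (K.1 ^ (k + 1)) w y := pos_of_mul_pos_right hw (kernel_nonneg K z w)
    obtain ⟨y', h1, m, hm⟩ := ih w hwy
    by_cases hwS : w ∈ S
    · refine ⟨⟨w, hwS⟩, hzw.trans_le (le_hit S z hwS), m + 1, ?_⟩
      rw [pow_succ', mul_apply]
      refine Finset.sum_pos' (fun z _ => mul_nonneg (kernel_nonneg _ _ z)
        (pow_nonneg_entry _ m z y)) ⟨y', Finset.mem_univ _, mul_pos ?_ hm⟩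
      rw [traceKernel_apply]
      exact h1
    · exact ⟨y', (mul_pos hzw h1).trans_le (mul_hit_le_hit S z hwS y'.2), m, hm⟩

lemma IsLazyReversible.trace (h : IsLazyReversible K π) (hS : S.Nonempty) :
    IsLazyReversible (traceKernel S h) (condLaw π S) where
  prob := by
    have hpos : 0 < ∑ y ∈ S, π y := Finset.sum_pos (fun y _ => h.pos y) hS
    refine ⟨fun x => div_nonneg (h.nonneg x) hpos.le, ?_⟩
    simp only [condLaw]
    rw [← Finset.sum_div, Finset.sum_coe_sort S π, div_self hpos.ne']
  detailed_balance x y := by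
    rw [traceKernel_apply, traceKernel_apply, condLaw, condLaw, div_mul_eq_mul_div,
      div_mul_eq_mul_div, h.hit_balance S x.2 y.2]
  irreducible := by
    rw [isIrreducible_iff_exists_pow_pos (kernel_nonneg _)]
    intro x y
    obtain ⟨k, hk, hpos⟩ :=
      (isIrreducible_iff_exists_pow_pos (kernel_nonneg K)).1 h.irreducible x y
    obtain ⟨k, rfl⟩ := Nat.exists_eq_succ_of_ne_zero hk.ne'
    obtain ⟨y', h1, m, hm⟩ := exists_pos_hit_of_pow_pos S h (x : Θ) y hpos
    refine ⟨m + 1, Nat.succ_pos m, ?_⟩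
    rw [pow_succ', mul_apply]
    refine Finset.sum_pos' (fun z _ => mul_nonneg (kernel_nonneg _ _ z)
      (pow_nonneg_entry _ m z y)) ⟨y', Finset.mem_univ _, mul_pos ?_ hm⟩
    rw [traceKernel_apply]
    exact h1
  lazy x := by
    rw [traceKernel_apply]
    exact (h.lazy x).trans (le_hit S x x.2)

end FirstVisit

/-! ### Visits to a part before meeting a set -/

section Occupation

variable {Θ : Type u} [Fintype Θ] [DecidableEq Θ]

omit [Fintype Θ] in
lemma occupation_consPath (S : Finset Θ) (x : Θ) (Z : ℕ → Θ) (T : ℕ) :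
    occupation S (consPath x Z) (T + 1) = (if Z 0 ∈ S then 1 else 0) + occupation S Z T := by
  induction T with
  | zero =>
    simp only [occupation, zero_add, Finset.Icc_self, Finset.sum_singleton]
    rfl
  | succ T ih =>
    unfold occupation at ih ⊢
    rw [Finset.sum_Icc_succ_top (by omega), ih, Finset.sum_Icc_succ_top (by omega), ← add_assoc]
    rfl

/-- The trajectories that visit `S` at least `m` times up to time `T` without meeting `A`. -/
def visitAvoid (S A : Finset Θ) (T m : ℕ) : Set (ℕ → Θ) :=
  {Z | m ≤ occupation S Z T ∧ ∀ s, 1 ≤ s → s ≤ T → Z s ∉ A}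

omit [Fintype Θ] in
lemma consPath_mem_visitAvoid (S A : Finset Θ) (x : Θ) (Z : ℕ → Θ) (T m : ℕ) :
    consPath x Z ∈ visitAvoid S A (T + 1) (m + 1) ↔
      Z 0 ∉ A ∧ Z ∈ visitAvoid S A T (if Z 0 ∈ S then m else m + 1) := by
  simp only [visitAvoid, Set.mem_ofPred_eq, occupation_consPath]
  have h : (∀ s, 1 ≤ s → s ≤ T + 1 → consPath x Z s ∉ A) ↔
      Z 0 ∉ A ∧ ∀ s, 1 ≤ s → s ≤ T → Z s ∉ A := by
    constructor
    · intro h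
      exact ⟨h 1 le_rfl (by omega), fun s hs hsT => h (s + 1) (by omega) (by omega)⟩
    · rintro ⟨h0, h⟩ s hs hsT
      obtain ⟨s, rfl⟩ := Nat.exists_eq_succ_of_ne_zero (by omega : s ≠ 0)
      rcases Nat.eq_zero_or_pos s with rfl | hs'
      · exact h0
      · exact h s hs' (by omega)
  rw [h]
  split_ifs
  · rw [add_comm 1, Nat.add_le_add_iff_right]
    tauto
  · rw [zero_add]
    tauto

variable [MeasurableSpace Θ] [DiscreteMeasurableSpace Θ]

omit [Fintype Θ] in
lemma measurable_occupation (S : Finset Θ) (T : ℕ) :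
    Measurable fun Z : ℕ → Θ => occupation S Z T :=
  Finset.measurable_sum _ fun s _ => Measurable.ite (measurableSet_coord_mem s (S : Set Θ))
    measurable_const measurable_const

omit [Fintype Θ] in
lemma measurableSet_visitAvoid (S A : Finset Θ) (T m : ℕ) :
    MeasurableSet (visitAvoid S A T m) := by
  have : visitAvoid S A T m = (fun Z : ℕ → Θ => occupation S Z T) ⁻¹' Set.Ici m ∩
      ⋂ s ∈ Set.Icc 1 T, {Z | Z s ∈ ((A : Set Θ)ᶜ)} := by
    ext Z
    simp [visitAvoid]
  rw [this]
  exact (measurable_occupation S T (MeasurableSet.of_discrete)).inter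
    (MeasurableSet.biInter (Set.to_countable _) fun s _ => measurableSet_coord_mem s _)

variable {K : rowStochastic ℝ Θ} {π : Θ → ℝ}

/-- Visits of the chain to `S` before meeting `A` are governed by the trace on `S`. -/
lemma IsLazyReversible.pathLaw_visitAvoid_le (h : IsLazyReversible K π) (S A : Finset Θ)
    (T m : ℕ) (z : Θ) :
    (pathLaw K z).real (visitAvoid S A T (m + 1)) ≤
      ∑ y : S, hit K S z y *
        surv (traceKernel S h) (Finset.univ.filter fun y : S => (y : Θ) ∈ A) m y := by
  set B : Finset S := Finset.univ.filter fun y : S => (y : Θ) ∈ A with hB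
  have hnn : ∀ m (z : Θ), 0 ≤ ∑ y : S, hit K S z y * surv (traceKernel S h) B m y :=
    fun m z => Finset.sum_nonneg fun y _ => mul_nonneg (hit_nonneg K S z y) (surv_nonneg _ B m y)
  induction T generalizing m z with
  | zero =>
    have e : visitAvoid S A 0 (m + 1) = ∅ := by
      ext Z; simp [visitAvoid, occupation]
    rw [e, measureReal_empty]
    exact hnn m z
  | succ T ih =>
    have hA : ∀ w ∈ A, (pathLaw K w).real
        (consPath z ⁻¹' visitAvoid S A (T + 1) (m + 1)) = 0 := fun w hw => by
      rw [pathLaw_real_congr K w (F := ∅), measureReal_empty]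
      intro Z hZ
      simp [consPath_mem_visitAvoid, hZ, hw]
    -- A first step into `S` outside `A` uses up one visit, so `m` visits remain to be made and the
    -- trace advances by one step.
    have hin : ∀ w : S, (pathLaw K w).real
        (consPath z ⁻¹' visitAvoid S A (T + 1) (m + 1)) ≤ surv (traceKernel S h) B m w := by
      intro w
      by_cases hw : (w : Θ) ∈ A
      · rw [hA w hw]
        exact surv_nonneg _ B m w
      · have hwB : w ∉ B := by simpa [hB] using hw
        rw [pathLaw_real_congr K w (F := visitAvoid S A T m)]
        · cases m with
          | zero =>
            have e : surv (traceKernel S h) B 0 w = 1 := by simp [surv, hwB]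
            rw [e]
            exact measureReal_le_one
          | succ m =>
            rw [surv_succ_of_notMem _ B hwB]
            simp only [traceKernel_apply]
            exact ih m w
        · intro Z hZ
          simp [consPath_mem_visitAvoid, hZ, hw]
    -- A first step outside `S` leaves the visit count unchanged; only the time horizon shrinks.
    have hout : ∀ w ∈ Sᶜ, (pathLaw K w).real
        (consPath z ⁻¹' visitAvoid S A (T + 1) (m + 1)) ≤
        ∑ y : S, hit K S w y * surv (traceKernel S h) B m y := by
      intro w hwS
      by_cases hw : w ∈ A
      · rw [hA w hw]
        exact hnn m w
      · rw [pathLaw_real_congr K w (F := visitAvoid S A T (m + 1))]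
        · exact ih m w
        · intro Z hZ
          simp [consPath_mem_visitAvoid, hZ, hw, Finset.mem_compl.1 hwS]
    have hrhs : ∑ y : S, hit K S z y * surv (traceKernel S h) B m y =
        ∑ y : S, K.1 z y * surv (traceKernel S h) B m y +
          ∑ w ∈ Sᶜ, K.1 z w * ∑ y : S, hit K S w y * surv (traceKernel S h) B m y := by
      simp only [Finset.mul_sum]
      rw [Finset.sum_comm, ← Finset.sum_add_distrib]
      refine Finset.sum_congr rfl fun y _ => ?_
      rw [hit_eq K S z y.2, add_mul, Finset.sum_mul]
      congr 1
      exact Finset.sum_congr rfl fun w _ => mul_assoc _ _ _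
    rw [hrhs, pathLaw_real_apply K z (measurableSet_visitAvoid S A _ _),
      ← Finset.sum_add_sum_compl S, ← Finset.sum_coe_sort S]
    exact add_le_add
      (Finset.sum_le_sum fun w _ => mul_le_mul_of_nonneg_left (hin w) (kernel_nonneg K z w))
      (Finset.sum_le_sum fun w hw => mul_le_mul_of_nonneg_left (hout w hw) (kernel_nonneg K z w))

end Occupation

/-! ### From the trace to the full chain -/

section Comparison

variable {Θ : Type u} [Fintype Θ] [DecidableEq Θ] [MeasurableSpace Θ] [DiscreteMeasurableSpace Θ]
  {K : rowStochastic ℝ Θ} {π : Θ → ℝ}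

lemma maxHittingTime_le_of_surv_le {α p : ℝ} (hp : p < 1) {T : ℕ}
    (hs : ∀ A : Finset Θ, α ≤ ∑ y ∈ A, π y → ∀ x, surv K A T x ≤ p) :
    maxHittingTime K π α ≤ ENNReal.ofReal (T / (1 - p)) := by
  refine iSup_le fun x => iSup₂_le fun A hA => ?_
  rw [lintegral_hittingTime]
  exact tsum_surv_le K A hp (hs A hA) x

/-- The hitting time of a substantial part of `S`, by the trace on `S`, satisfies a Markov bound
in terms of the mixing time of the trace. -/
lemma IsLazyReversible.surv_trace_le (h : IsLazyReversible K π) {γ c' : ℝ} (hγ : 0 < γ)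
    (hc' : IsLowerConstant.{u} γ c') {S : Finset Θ} (hS : S.Nonempty) {B : Finset S}
    (hB : γ ≤ ∑ y ∈ B, condLaw π S y) {t : ℝ} (ht : 0 < t) {m : ℕ} (hm : t ≤ m + 1) (y : S) :
    ENNReal.ofReal (surv (traceKernel S h) B m y) ≤
      ENNReal.ofReal c' * traceMixingTime K π S / ENNReal.ofReal t := by
  rcases subsingleton_or_nontrivial S with hsub | hnt
  · have hy : y ∈ B := by
      have hne : B.Nonempty := by
        by_contra hne
        rw [Finset.not_nonempty_iff_eq_empty] at hne
        rw [hne, Finset.sum_empty] at hB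
        linarith
      obtain ⟨y', hy'⟩ := hne
      rwa [Subsingleton.elim y y']
    rw [surv_of_mem _ _ hy]
    simp
  · rw [ENNReal.le_div_iff_mul_le (Or.inl (ENNReal.ofReal_pos.2 ht).ne')
      (Or.inl ENNReal.ofReal_ne_top)]
    refine le_trans ?_ (hc'.2 S (traceKernel S h) (condLaw π S) (h.trace S hS))
    refine le_trans ?_ (le_iSup_of_le y (le_iSup₂_of_le B hB le_rfl))
    rw [lintegral_hittingTime]
    refine le_trans ?_ (mul_surv_le_tsum _ B m y)
    rw [mul_comm]
    refine mul_le_mul_left ?_ _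
    rw [← ENNReal.ofReal_natCast]
    exact ENNReal.ofReal_le_ofReal (by push_cast; exact hm)

lemma IsLazyReversible.surv_le_of_occupation (h : IsLazyReversible K π) {γ c' : ℝ} (hγ : 0 < γ)
    (hc' : IsLowerConstant.{u} γ c') {S A : Finset Θ} (hS : S.Nonempty)
    (hA : γ * ∑ y ∈ S, π y ≤ ∑ y ∈ S ∩ A, π y) {t : ℝ} (ht : 0 < t) {T : ℕ}
    (hlt : ENNReal.ofReal c' * traceMixingTime K π S / ENNReal.ofReal t +
      ⨆ z, pathLaw K z {Z | (occupation S Z T : ℝ) < t} < 1 / 4) (z : Θ) :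
    surv K A T z ≤ 1 / 4 := by
  set B : Finset S := Finset.univ.filter fun y : S => (y : Θ) ∈ A with hB
  have hSpos : 0 < ∑ y ∈ S, π y := Finset.sum_pos (fun y _ => h.pos y) hS
  have hBmass : γ ≤ ∑ y ∈ B, condLaw π S y := by
    have e : ∑ y ∈ B, condLaw π S y = (∑ y ∈ S ∩ A, π y) / ∑ y ∈ S, π y := by
      simp only [condLaw]
      rw [← Finset.sum_div, hB, Finset.sum_filter,
        Finset.sum_coe_sort S fun y => if y ∈ A then π y else 0, ← Finset.sum_filter,
        Finset.filter_mem_eq_inter]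
    rw [e, le_div_iff₀ hSpos]
    exact hA
  set X := ENNReal.ofReal c' * traceMixingTime K π S / ENNReal.ofReal t with hX
  -- Here `m + 1 = ⌈t⌉₊`: at least `t` visits means at least `m + 1`, and Markov's inequality at `m`
  -- divides by `m + 1 ≥ t`.
  obtain ⟨m, hm⟩ := Nat.exists_eq_succ_of_ne_zero (Nat.ceil_pos.2 ht).ne'
  have hmt : t ≤ m + 1 := by
    have := Nat.le_ceil t
    rw [hm] at this
    push_cast at this
    exact this
  have hXtop : X ≠ ⊤ := ((le_self_add.trans_lt hlt).trans_le le_top).ne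
  have hvis : pathLaw K z (visitAvoid S A T (m + 1)) ≤ X := by
    rw [← ENNReal.ofReal_toReal (measure_ne_top (pathLaw K z) _), ← ENNReal.ofReal_toReal hXtop]
    refine ENNReal.ofReal_le_ofReal ((h.pathLaw_visitAvoid_le S A T m z).trans ?_)
    have h1 : ∀ y : S, surv (traceKernel S h) B m y ≤ X.toReal := fun y => by
      rw [← ENNReal.ofReal_le_iff_le_toReal hXtop]
      exact h.surv_trace_le hγ hc' hS hBmass ht hmt y
    have h2 : ∑ y : S, hit K S z y ≤ 1 := by
      rw [Finset.sum_coe_sort S fun y => hit K S z y]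
      exact sum_hit_le_one K S z
    calc ∑ y : S, hit K S z y * surv (traceKernel S h) B m y
        ≤ ∑ y : S, hit K S z y * X.toReal :=
          Finset.sum_le_sum fun y _ => mul_le_mul_of_nonneg_left (h1 y) (hit_nonneg K S z y)
      _ ≤ X.toReal := by
          rw [← Finset.sum_mul]
          exact mul_le_of_le_one_left ENNReal.toReal_nonneg h2
  have hsub : {Z : ℕ → Θ | ∀ s ≤ T, Z s ∉ A} ⊆
      visitAvoid S A T (m + 1) ∪ {Z | (occupation S Z T : ℝ) < t} := by
    intro Z hZ
    by_cases hocc : (occupation S Z T : ℝ) < t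
    · exact Or.inr hocc
    · refine Or.inl ⟨?_, fun s _ hs => hZ s hs⟩
      have := Nat.ceil_le.2 (not_lt.1 hocc)
      omega
  have h3 : ENNReal.ofReal (surv K A T z) ≤ 1 / 4 := by
    rw [← pathLaw_avoid]
    refine ((measure_mono hsub).trans (measure_union_le _ _)).trans (le_trans ?_ hlt.le)
    exact add_le_add hvis (le_iSup (fun z => pathLaw K z {Z | (occupation S Z T : ℝ) < t}) z)
  rw [show (1 / 4 : ℝ≥0∞) = ENNReal.ofReal (1 / 4) by
    rw [ENNReal.ofReal_div_of_pos (by norm_num)]; simp] at h3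
  exact (ENNReal.ofReal_le_ofReal_iff (by norm_num)).1 h3

end Comparison

/-! ### Degenerate state spaces and mass distribution among the parts -/

section Constants

/-- The two-state chain that resamples its state uniformly. -/
def uniformTwoState : rowStochastic ℝ (ULift.{u} Bool) :=
  ⟨fun _ _ => 1 / 2, mem_rowStochastic_iff_sum.2 ⟨fun _ _ => by norm_num, fun _ => by
    simp [Fintype.card_ulift]⟩⟩

lemma isLazyReversible_uniformTwoState :
    IsLazyReversible uniformTwoState.{u} (fun _ => 1 / 2) where
  prob := ⟨fun _ => by norm_num, by simp [Fintype.card_ulift]⟩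
  detailed_balance _ _ := rfl
  irreducible := by
    rw [isIrreducible_iff_exists_pow_pos (kernel_nonneg _)]
    exact fun x y => ⟨1, one_pos, by rw [pow_one]; norm_num [uniformTwoState]⟩
  lazy _ := le_rfl

/-- For the uniform two-state chain the mixing time is at least one, while a nonempty set is missed
in one step with probability at most one half, so `t_H ≤ 2`. This lower bound on `c` handles the
one-point state space in the main bound. -/
lemma IsUpperConstant.half_le {α c : ℝ} (hα : 0 < α) (hc : IsUpperConstant.{u} α c) :
    1 / 2 ≤ c := by
  let : MeasurableSpace (ULift.{u} Bool) := ⊤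
  have : DiscreteMeasurableSpace (ULift.{u} Bool) := ⟨fun _ => trivial⟩
  have h1 := (one_le_mixingTime _ _).trans
    (hc.2 (ULift.{u} Bool) uniformTwoState _ isLazyReversible_uniformTwoState)
  have h2 : maxHittingTime uniformTwoState.{u} (fun _ => 1 / 2) α ≤
      ENNReal.ofReal ((1 : ℕ) / (1 - 1 / 2)) := by
    refine maxHittingTime_le_of_surv_le (by norm_num) fun A hA x => ?_
    obtain ⟨y, hy⟩ : A.Nonempty := by
      by_contra hne
      rw [Finset.not_nonempty_iff_eq_empty] at hne
      rw [hne, Finset.sum_empty] at hA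
      linarith
    by_cases hx : x ∈ A
    · rw [surv_of_mem _ _ hx]; norm_num
    · rw [surv_succ_of_notMem _ _ hx]
      have h3 := Finset.add_sum_erase Finset.univ
        (fun z => (uniformTwoState.{u}).1 x z * surv uniformTwoState A 0 z) (Finset.mem_univ y)
      rw [← h3, surv_of_mem _ _ hy, mul_zero, zero_add]
      refine (Finset.sum_le_sum (g := fun _ => (1 / 2 : ℝ)) fun z _ => ?_).trans ?_
      · have := surv_le_one uniformTwoState A 0 z
        change 1 / 2 * _ ≤ (1 / 2 : ℝ)
        linarith
      · rw [Finset.sum_const, Finset.card_erase_of_mem (Finset.mem_univ y)]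
        simp [Fintype.card_ulift]
  have h4 := h1.trans (mul_le_mul_right h2 _)
  rw [← ENNReal.ofReal_mul hc.1.le, ← ENNReal.ofReal_one,
    ENNReal.ofReal_le_ofReal_iff (mul_nonneg hc.1.le (by norm_num))] at h4
  norm_num at h4
  linarith

lemma IsLazyReversible.mixingTime_of_subsingleton {Θ : Type u} [Fintype Θ] [DecidableEq Θ]
    [Subsingleton Θ] {K : rowStochastic ℝ Θ} {π : Θ → ℝ} (h : IsLazyReversible K π) :
    mixingTime K.1 π ≤ 1 := by
  have := mixingTime_le (K := K.1) (π := π) one_pos fun x => by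
    refine lt_of_le_of_lt (ciSup_le fun A => ?_) (by norm_num : (0 : ℝ) < 1 / 4)
    rw [← Finset.sum_sub_distrib]
    refine (Finset.sum_eq_zero fun y _ => ?_).le
    have h1 := kernel_sum K x
    have h2 := h.sum_eq_one
    rw [Fintype.sum_subsingleton _ y] at h1 h2
    rw [pow_one, h1, h2, sub_self]
  simpa using this

end Constants

/-- If `A` filled less than `γ` of every nonempty part, its complement would have mass at least `(1
- γ)` times the total mass of those parts. That exceeds `(1 - γ) β ≥ 1 - a`, a contradiction. -/
lemma exists_part_of_mass {Θ : Type u} [Fintype Θ] [DecidableEq Θ] {π : Θ → ℝ}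
    (hπ : ∀ x, 0 ≤ π x) (hsum : ∑ x, π x = 1) {n : ℕ} {part : Fin n → Finset Θ}
    (hdisj : ∀ j k, j ≠ k → Disjoint (part j) (part k)) {I : Finset (Fin n)} {a β γ : ℝ}
    (hβ0 : 0 < β) (ha : a < 1) (hγ : γ ≤ (a + β - 1) / β)
    (hI : β < ∑ k ∈ I, ∑ x ∈ part k, π x) {A : Finset Θ} (hA : a ≤ ∑ y ∈ A, π y) :
    ∃ k ∈ I, (part k).Nonempty ∧ γ * ∑ y ∈ part k, π y ≤ ∑ y ∈ part k ∩ A, π y := by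
  by_contra hne
  push Not at hne
  have hsplit : ∀ k, ∑ y ∈ part k ∩ A, π y + ∑ y ∈ part k \ A, π y = ∑ y ∈ part k, π y :=
    fun k => Finset.sum_inter_add_sum_sdiff _ _ _
  have hout : ∑ k ∈ I, ∑ y ∈ part k \ A, π y ≤ 1 - a := by
    rw [← Finset.sum_biUnion fun j _ k _ hjk =>
      (hdisj j k hjk).mono Finset.sdiff_subset Finset.sdiff_subset]
    have h1 : ∑ y ∈ I.biUnion (fun k => part k \ A), π y ≤ ∑ y ∈ Aᶜ, π y :=
      Finset.sum_le_sum_of_subset_of_nonneg (fun y hy => by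
        obtain ⟨k, -, hk⟩ := Finset.mem_biUnion.1 hy
        exact Finset.mem_compl.2 (Finset.mem_sdiff.1 hk).2) fun y _ _ => hπ y
    have h2 := Finset.sum_add_sum_compl A π
    linarith
  have hin : ∑ k ∈ I, ∑ y ∈ part k ∩ A, π y ≤ γ * ∑ k ∈ I, ∑ y ∈ part k, π y := by
    rw [Finset.mul_sum]
    refine Finset.sum_le_sum fun k hk => ?_
    rcases (part k).eq_empty_or_nonempty with h | h
    · simp [h]
    · exact (hne k hk h).le
  have htot : ∑ k ∈ I, ∑ y ∈ part k ∩ A, π y + ∑ k ∈ I, ∑ y ∈ part k \ A, π y =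
      ∑ k ∈ I, ∑ y ∈ part k, π y := by
    rw [← Finset.sum_add_distrib]
    exact Finset.sum_congr rfl fun k _ => hsplit k
  rw [le_div_iff₀ hβ0] at hγ
  have h1 : 0 < 1 - γ := by
    by_contra hle
    nlinarith
  nlinarith

end

end DecomposableChain

theorem lemma3p1 :
    (∀ α : ℝ, 0 < α → α < 1 / 2 →
      (∃ c, DecomposableChain.IsUpperConstant.{u} α c) ∧
      (∃ c', DecomposableChain.IsLowerConstant.{u} α c')) ∧
    ∀ a β : ℝ, 0 < a → a < 1 / 2 → 1 - a < β → β < 1 →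
    ∀ γ : ℝ, γ = min (1 / 2) ((a + β - 1) / β) →
    ∀ c c' : ℝ, DecomposableChain.IsUpperConstant.{u} a c →
      DecomposableChain.IsLowerConstant.{u} γ c' →
    ∀ (Θ : Type u) [Fintype Θ] [DecidableEq Θ] [MeasurableSpace Θ] [DiscreteMeasurableSpace Θ]
      (K : Matrix.rowStochastic ℝ Θ) (π : Θ → ℝ), DecomposableChain.IsLazyReversible K π →
    ∀ (n : ℕ) (part : Fin n → Finset Θ),
      (∀ j k, j ≠ k → Disjoint (part j) (part k)) → (∀ x, ∃ k, x ∈ part k) →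
    ∀ I : Finset (Fin n), β < ∑ k ∈ I, ∑ x ∈ part k, π x →
      DecomposableChain.mixingTime K.1 π / (4 * ENNReal.ofReal c) ≤
        DecomposableChain.occupationBound K π part I c' := by
  open DecomposableChain in
  refine ⟨fun α h0 h1 => ⟨exists_isUpperConstant h1.le, exists_isLowerConstant h0⟩, ?_⟩
  intro a β ha ha2 hβ hβ1 γ hγ c c' hc hc' Θ _ _ _ _ K π h n part hdisj _ I hI
  have hβ0 : 0 < β := by linarith
  have hγ0 : 0 < γ := by
    rw [hγ]
    exact lt_min (by norm_num) (div_pos (by linarith) hβ0)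
  have hcpos : 0 < c := hc.1
  refine le_iInf₂ fun T hT => ?_
  simp only [iInf_lt_iff] at hT
  obtain ⟨t, ⟨ht0, htT⟩, ht⟩ := hT
  have hTpos : 1 ≤ T := Nat.one_le_iff_ne_zero.2 fun h0 => by
    rw [h0, Nat.cast_zero] at htT
    linarith
  have e4 : (4 * ENNReal.ofReal c) = ENNReal.ofReal (4 * c) := by
    rw [ENNReal.ofReal_mul (by norm_num)]; simp
  refine ENNReal.div_le_of_le_mul ?_
  rw [e4, ← ENNReal.ofReal_natCast, ← ENNReal.ofReal_mul (by positivity)]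
  have hTR : (1 : ℝ) ≤ T := by exact_mod_cast hTpos
  rcases subsingleton_or_nontrivial Θ with hsub | hnt
  -- On one point the mixing time is one although hitting times vanish; `1 ≤ T * (4 c)` follows from
  -- `c ≥ 1/2` and `T ≥ 1`.
  · refine h.mixingTime_of_subsingleton.trans ?_
    rw [← ENNReal.ofReal_one]
    refine ENNReal.ofReal_le_ofReal ?_
    nlinarith [hc.half_le ha]
  · refine (hc.2 Θ K π h).trans ?_
    -- The part `k` may depend on `A`, but `t` was chosen before `A` and works for every `k ∈ I`.
    -- The resulting `4/3` is below the factor `4` required.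
    have hmax : maxHittingTime K π a ≤ ENNReal.ofReal (T / (1 - 1 / 4)) :=
      maxHittingTime_le_of_surv_le (by norm_num) fun A hA z => by
        obtain ⟨k, hk, hne, hmass⟩ := exists_part_of_mass h.nonneg h.sum_eq_one hdisj hβ0
          (by linarith) (hγ.le.trans (min_le_right _ _)) hI hA
        exact h.surv_le_of_occupation hγ0 hc' hne hmass ht0
          (lt_of_le_of_lt (le_iSup₂_of_le k hk le_rfl) ht) z
    refine (mul_le_mul_right hmax _).trans ?_
    rw [← ENNReal.ofReal_mul hcpos.le]
    refine ENNReal.ofReal_le_ofReal ?_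
    have : 0 < (T : ℝ) * c := by positivity
    norm_num
    linarith
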